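/- Let $\mathcal A=\{H_1,\dots,H_n\}$ be a central arrangement of $n\ge 1$ distinct hyperplanes in $\mathbb C^{\ell+1}$ ($\ell\ge 0$), with complement $M\subset\mathbb C^{\ell+1}$, and let $U\subset\mathbb{CP}^{\ell}$ be the complement of the projectivized arrangement. Let $\mathbb K$ be an algebraically closed field and let $\tau:(\mathbb K^\times)^n\to\mathbb K^\times$, $\tau(t_1,\dots,t_n)=t_1\cdots t_n$. For $\mathbf t\in(\mathbb K^\times)^n$ let $\mathbb K_{\mathbf t}$ be the rank one local system on $M$ given by the character $\pi_1(M)\to H_1(M;\mathbb Z)\cong\mathbb Z^n\to\mathbb K^\times$ that takes the value $t_i$ on the meridians about $H_i$. If $\tau(\mathbf t)=1$, this character factors uniquely through the surjection $\pi_1(M)\to\pi_1(U)$ induced by the Hopf map, and the resulting local system on $U$ is also denoted $\mathbb K_{\mathbf t}$. For integers $q,d\ge 0$ put $$\Sigma^q_d(M)=\{\mathbf t\in(\mathbb K^\times)^n\mid \dim_{\mathbb K}H^q(M;\mathbb K_{\mathbf t})\ge d\},\qquad \Sigma^q_d(U)=\{\mathbf t\in\ker\tau\mid \dim_{\mathbb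 K}H^q(U;\mathbb K_{\mathbf t})\ge d\},$$ and, for $X=M$ or $X=U$, let $\operatorname{depth}^q_X(\mathbf t)$ be the largest $d$ with $\mathbf t\in\Sigma^q_d(X)$. Then, for every $q\ge 1$: 1. for every $d\ge 1$, $\displaystyle \Sigma^q_d(M)=\bigcup_{j=0}^d\bigl(\Sigma^q_{d-j}(U)\cap\Sigma^{q-1}_j(U)\bigr)$; 2. for every $d\ge 0$, $\displaystyle \Sigma^q_d(M)\cap\ker\tau=\bigcup_{j=0}^d\bigl(\Sigma^q_{d-j}(U)\cap\Sigma^{q-1}_j(U)\bigr)$; 3. for every $\mathbf t\in\ker\tau$, $\operatorname{depth}^q_M(\mathbf t)=\operatorname{depth}^q_U(\mathbf t)+\operatorname{depth}^{q-1}_U(\mathbf t)$. -/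

import Mathlib

open CategoryTheory

universe u v w

noncomputable section

namespace LocalCoefficients

/-! ### Singular cohomology with coefficients in a local system -/

/-- The standard topological `n`-simplex. -/
abbrev Simplex (n : SimplexCategory) : Type := stdSimplex ℝ (Fin (n.len + 1))

instance contractibleSpace_simplex (n : SimplexCategory) : ContractibleSpace (Simplex n) :=
  (convex_stdSimplex ℝ (Fin (n.len + 1))).contractibleSpace
    ⟨_, single_mem_stdSimplex ℝ (0 : Fin (n.len + 1))⟩

/-- The affine map of simplices induced by a monotone map of vertices. -/
def simplexMap {m n : SimplexCategory} (θ : m ⟶ n) : C(Simplex m, Simplex n) :=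
  ⟨stdSimplex.map θ.toOrderHom, stdSimplex.continuous_map _⟩

lemma simplexMap_id (n : SimplexCategory) : simplexMap (𝟙 n) = ContinuousMap.id _ :=
  ContinuousMap.ext fun x => stdSimplex.map_id_apply x

lemma simplexMap_comp {m n k : SimplexCategory} (θ : m ⟶ n) (η : n ⟶ k) :
    simplexMap (θ ≫ η) = (simplexMap η).comp (simplexMap θ) :=
  ContinuousMap.ext fun x =>
    (stdSimplex.map_comp_apply θ.toOrderHom η.toOrderHom x).symm

/-- The initial vertex of the standard topological simplex. -/
def initialVertex (n : SimplexCategory) : Simplex n :=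
  stdSimplex.vertex (S := ℝ) (0 : Fin (n.len + 1))

/-- The unique homotopy class of paths between two points of a standard topological simplex. -/
def simplexPath {n : SimplexCategory} (a b : Simplex n) :
    FundamentalGroupoid.mk a ⟶ FundamentalGroupoid.mk b :=
  Path.Homotopic.Quotient.mk (PathConnectedSpace.somePath a b)

lemma simplex_hom_eq {n : SimplexCategory} {a b : FundamentalGroupoid (Simplex n)}
    (f g : a ⟶ b) : f = g :=
  Subsingleton.elim (α := Path.Homotopic.Quotient a.as b.as) f g

variable {K : Type u} [Field K] {X : Type w} [TopologicalSpace X]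

/-- A local system of `K`-vector spaces on `X`: a functor from the fundamental groupoid. -/
abbrev LocalSystem (K : Type u) [Field K] (X : Type w) [TopologicalSpace X] :=
  FundamentalGroupoid X ⥤ ModuleCat.{v} K

/-- Singular `n`-cochains of `X` with values in `L`: to every singular simplex `σ`, an element of
the fibre of `L` at the image of the initial vertex. -/
abbrev Cochain (L : LocalSystem.{u, v, w} K X) (n : SimplexCategory) : Type (max v w) :=
  ∀ σ : C(Simplex n, X), L.obj ⟨σ (initialVertex n)⟩

/-- The operator on cochains induced by `θ : [m] ⟶ [n]`. It sends `c` to the cochain whose value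
on `σ` is `c (σ ∘ θ)`, transported along the image under `σ` of the path in the simplex from
`θ (v₀)` to `v₀`. -/
def cochainMap (L : LocalSystem.{u, v, w} K X) {m n : SimplexCategory} (θ : m ⟶ n) :
    Cochain L m →ₗ[K] Cochain L n :=
  LinearMap.pi fun σ =>
    (L.map ((FundamentalGroupoid.map σ).map
      (simplexPath ((simplexMap θ) (initialVertex m))
        (initialVertex n)))).hom ∘ₗ
    LinearMap.proj (σ.comp (simplexMap θ))

lemma cochainMap_apply (L : LocalSystem.{u, v, w} K X) {m n : SimplexCategory} (θ : m ⟶ n)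
    (c : Cochain L m) (σ : C(Simplex n, X)) :
    cochainMap L θ c σ =
      (L.map ((FundamentalGroupoid.map σ).map
        (simplexPath ((simplexMap θ) (initialVertex m))
          (initialVertex n)))).hom (c (σ.comp (simplexMap θ))) := rfl

lemma map_eq_of_eq (L : LocalSystem.{u, v, w} K X) {m n : SimplexCategory} (c : Cochain L m)
    (σ : C(Simplex n, X))
    {f g : C(Simplex m, Simplex n)} (h : f = g)
    (b : Simplex n)
    (p : FundamentalGroupoid.mk (f (initialVertex m)) ⟶ FundamentalGroupoid.mk b)
    (q : FundamentalGroupoid.mk (g (initialVertex m)) ⟶ FundamentalGroupoid.mk b) :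
    (L.map ((FundamentalGroupoid.map σ).map p)).hom (c (σ.comp f)) =
      (L.map ((FundamentalGroupoid.map σ).map q)).hom (c (σ.comp g)) := by
  subst h
  rw [simplex_hom_eq p q]

lemma map_map_id {C D : Type*} [Category* C] [Category* D] (G : C ⥤ D) (L : D ⥤ ModuleCat.{v} K)
    (x : C) (a : L.obj (G.obj x)) : (L.map (G.map (𝟙 x))).hom a = a := by
  simp

lemma map_map_comp {C D : Type*} [Category* C] [Category* D] (G : C ⥤ D)
    (L : D ⥤ ModuleCat.{v} K) {x y z : C} (p : x ⟶ y) (r : y ⟶ z) (a : L.obj (G.obj x)) :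
    (L.map (G.map (p ≫ r))).hom a = (L.map (G.map r)).hom ((L.map (G.map p)).hom a) := by
  simp

/-- The cosimplicial `K`-vector space of singular cochains with coefficients in `L`. -/
def cochains (L : LocalSystem.{u, v, w} K X) :
    CosimplicialObject (ModuleCat.{max v w} K) where
  obj n := ModuleCat.of K (Cochain L n)
  map θ := ModuleCat.ofHom (cochainMap L θ)
  map_id n := by
    ext c σ
    have h := map_eq_of_eq L c σ (f := (simplexMap (𝟙 n)))
      (g := ContinuousMap.id _) (simplexMap_id n) (initialVertex n)
      (simplexPath _ _) (𝟙 _)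
    exact (cochainMap_apply L (𝟙 n) c σ).trans
      (h.trans (map_map_id (FundamentalGroupoid.map σ) L _ (c σ)))
  map_comp {m n k} θ η := by
    ext c σ
    have h := map_eq_of_eq L c σ (f := (simplexMap (θ ≫ η)))
      (g := (simplexMap η).comp (simplexMap θ))
      (simplexMap_comp θ η) (initialVertex k)
      (simplexPath _ _)
      ((FundamentalGroupoid.map (simplexMap η)).map
        (simplexPath ((simplexMap θ) (initialVertex m)) (initialVertex n)) ≫
        simplexPath ((simplexMap η) (initialVertex n)) (initialVertex k))
    exact (cochainMap_apply L (θ ≫ η) c σ).trans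
      (h.trans (map_map_comp (FundamentalGroupoid.map σ) L _ _ _))

/-- The singular cochain complex of `X` with coefficients in `L`, with differential
`(δc)(σ) = ∑ i, (-1)^i c (∂ᵢ σ)` (with the transport of `cochainMap`). -/
def cochainComplex (L : LocalSystem.{u, v, w} K X) :
    CochainComplex (ModuleCat.{max v w} K) ℕ :=
  (AlgebraicTopology.alternatingCofaceMapComplex _).obj (cochains L)

/-- The cohomology `H^q(X; L)`. -/
def cohomology (L : LocalSystem.{u, v, w} K X) (q : ℕ) : ModuleCat.{max v w} K :=
  (cochainComplex L).homology q

/-! ### The rank one local system of a character -/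

/-- The fibre at `x` of the rank one local system of a character `ρ` of `π₁(X, x₀)`: functions
on the homotopy classes of paths from `x₀` to `x` (the points over `x` of the universal cover)
that are equivariant under `π₁(X, x₀)`. -/
def rankOneFibre {x₀ : X} (ρ : FundamentalGroup X x₀ →* Kˣ) (x : FundamentalGroupoid X) :
    Submodule K ((FundamentalGroupoid.mk x₀ ⟶ x) → K) where
  carrier := {f | ∀ (g : FundamentalGroup X x₀) (γ : FundamentalGroupoid.mk x₀ ⟶ x),
    f (g.toArrow ≫ γ) = (ρ g : K) * f γ}
  add_mem' {a b} ha hb g γ := by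
    simp only [Pi.add_apply, ha g γ, hb g γ, mul_add]
  zero_mem' g γ := by simp
  smul_mem' c f hf g γ := by
    simp only [Pi.smul_apply, smul_eq_mul, hf g γ, mul_left_comm]

/-- The local system `K_ρ` of a character `ρ : π₁(X, x₀) → Kˣ`. The cochains of `X` with
coefficients in `K_ρ` are the `π₁(X, x₀)`-equivariant maps from the singular simplices of the
universal cover (pairs of a simplex of `X` and a class of paths from `x₀` to its initial vertex)
to `K`, on which `π₁(X, x₀)` acts through `ρ`. -/
def rankOne {x₀ : X} (ρ : FundamentalGroup X x₀ →* Kˣ) :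
    LocalSystem.{u, max u w, w} K X where
  obj x := ModuleCat.of K (rankOneFibre ρ x)
  map {x y} p := ModuleCat.ofHom
    { toFun := fun f => ⟨fun γ => f.1 (γ ≫ Groupoid.inv p), fun g γ => by
        have h := f.2 g (γ ≫ Groupoid.inv p)
        rw [← Category.assoc] at h
        exact h⟩
      map_add' := fun _ _ => rfl
      map_smul' := fun _ _ => rfl }
  map_id x := by
    ext f γ
    change f.1 (γ ≫ Groupoid.inv (𝟙 x)) = f.1 γ
    simp
  map_comp {x y z} p q := by
    ext f γ
    change f.1 (γ ≫ Groupoid.inv (p ≫ q)) = f.1 ((γ ≫ Groupoid.inv q) ≫ Groupoid.inv p)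
    simp

end LocalCoefficients

/-! ### Winding numbers -/

/-- The punctured plane `ℂ ∖ {0}`. -/
abbrev PuncturedPlane : Type := {z : ℂ // z ≠ 0}

/-- The universal covering `exp : ℂ → ℂ ∖ {0}`. -/
def expCover (z : ℂ) : PuncturedPlane := ⟨Complex.exp z, z.exp_ne_zero⟩

lemma isAddQuotientCoveringMap_expCover :
    IsAddQuotientCoveringMap expCover (AddSubgroup.zmultiples (2 * Real.pi * Complex.I)) :=
  Complex.isAddQuotientCoveringMap_exp

/-- The group of periods `2πiℤ` of the exponential is identified with `ℤ` by `2πik ↦ k`. -/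
def periodEquiv : AddSubgroup.zmultiples (2 * Real.pi * Complex.I) ≃+ ℤ :=
  (AddEquiv.ofBijective
    ((zmultiplesHom _) (⟨2 * Real.pi * Complex.I, AddSubgroup.mem_zmultiples _⟩ :
      AddSubgroup.zmultiples (2 * Real.pi * Complex.I))) (by
    constructor
    · intro a b h
      have h' : (a : ℂ) * (2 * Real.pi * Complex.I) = b * (2 * Real.pi * Complex.I) := by
        simpa using congrArg Subtype.val h
      exact_mod_cast mul_right_cancel₀ Complex.two_pi_I_ne_zero h'
    · rintro ⟨_, k, rfl⟩
      exact ⟨k, by ext; simp⟩)).symm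

/-- The winding number about `0` of (the class of) a loop in `ℂ ∖ {0}`: the integer `k` such that
the lift through `exp` of the loop that starts at `e` ends at `e + 2πik`. -/
def windingNumber (z : PuncturedPlane) : FundamentalGroup PuncturedPlane z →* Multiplicative ℤ :=
  (AddEquiv.toMultiplicative periodEquiv).toMonoidHom.comp
    ((MulEquiv.symm MulOpposite.opMulEquiv).toMonoidHom.comp
      (isAddQuotientCoveringMap_expCover.fundamentalGroupToMulOpposite
        ⟨Complex.log z.1, Subtype.ext (Complex.exp_log z.2)⟩))

lemma windingNumber_eq_of_lift {z : PuncturedPlane} (γ : Path z z) {e e' : ℂ} (Γ : Path e e')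
    (k : ℤ) (he : e' = e + k * (2 * Real.pi * Complex.I)) (hΓ : ∀ s, expCover (Γ s) = γ s) :
    windingNumber z (Path.Homotopic.Quotient.mk γ) = Multiplicative.ofAdd k := by
  have hz : Complex.exp e = z.1 := by
    have h := congrArg Subtype.val (hΓ 0)
    simpa [expCover] using h
  obtain ⟨m, hm⟩ := Complex.exp_eq_exp_iff_exists_int.1
    ((Complex.exp_log z.2).trans hz.symm)
  have hmem : (k : ℂ) * (2 * Real.pi * Complex.I) ∈
      AddSubgroup.zmultiples (2 * Real.pi * Complex.I : ℂ) := ⟨k, by simp⟩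
  let Γ' : Path (Complex.log z.1) (Complex.log z.1 + k * (2 * Real.pi * Complex.I)) :=
    { toFun := fun s => Γ s + m * (2 * Real.pi * Complex.I)
      continuous_toFun := by fun_prop
      source' := by simp [hm]
      target' := by simp [hm, he]; ring }
  have hper : ∀ x : ℂ, ∀ j : ℤ, Complex.exp (x + j * (2 * Real.pi * Complex.I)) =
      Complex.exp x := fun x j => Complex.exp_eq_exp_iff_exists_int.2 ⟨j, rfl⟩
  have key : isAddQuotientCoveringMap_expCover.fundamentalGroupToMulOpposite
      ⟨Complex.log z.1, Subtype.ext (Complex.exp_log z.2)⟩ (Path.Homotopic.Quotient.mk γ) =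
      MulOpposite.op (Multiplicative.ofAdd
        (⟨k * (2 * Real.pi * Complex.I), hmem⟩ :
          AddSubgroup.zmultiples (2 * Real.pi * Complex.I : ℂ))) := by
    rw [IsAddQuotientCoveringMap.fundamentalGroupToMulOpposite_apply_eq_Iff]
    have hend : expCover (Complex.log z.1 + k * (2 * Real.pi * Complex.I)) = z :=
      Subtype.ext ((hper _ k).trans (Complex.exp_log z.2))
    have := isAddQuotientCoveringMap_expCover.isCoveringMap.monodromy_eq_of_map_eq
      (γ := Path.Homotopic.Quotient.mk γ)
      (ex := ⟨Complex.log z.1, Subtype.ext (Complex.exp_log z.2)⟩)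
      (ey := ⟨Complex.log z.1 + k * (2 * Real.pi * Complex.I), hend⟩)
      (Path.Homotopic.Quotient.mk Γ') (by
        refine congrArg Path.Homotopic.Quotient.mk ?_
        ext s
        exact (hper _ m).trans (congrArg Subtype.val (hΓ s)))
    refine Eq.trans ?_ (congrArg Subtype.val this).symm
    exact add_comm _ _
  have hk : periodEquiv ⟨k * (2 * Real.pi * Complex.I), hmem⟩ = k := by
    rw [periodEquiv, AddEquiv.symm_apply_eq]
    ext
    change _ = (((zmultiplesHom _) (⟨2 * Real.pi * Complex.I, AddSubgroup.mem_zmultiples _⟩ :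
      AddSubgroup.zmultiples (2 * Real.pi * Complex.I : ℂ)) k : _) : ℂ)
    simp
  change Multiplicative.ofAdd (periodEquiv (Multiplicative.toAdd (MulOpposite.unop
    (isAddQuotientCoveringMap_expCover.fundamentalGroupToMulOpposite _ _)))) = _
  rw [key]
  exact congrArg Multiplicative.ofAdd hk

/-- The winding number of a loop that goes along `c`, once around a loop `δ`, and back along `c`,
read off from a lift of `δ`. -/
lemma windingNumber_conj {z b : PuncturedPlane} (c : Path z b) (δ : Path b b) (k : ℤ)
    (h : ∀ e : ℂ, expCover e = b →
      ∃ Δ : Path e (e + k * (2 * Real.pi * Complex.I)), ∀ s, expCover (Δ s) = δ s) :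
    windingNumber z (Path.Homotopic.Quotient.mk (c.trans (δ.trans c.symm))) =
      Multiplicative.ofAdd k := by
  obtain ⟨C, hC, -⟩ := isAddQuotientCoveringMap_expCover.isCoveringMap.exists_path_lifts
    c.toContinuousMap (Complex.log z.1)
    (c.source.trans (Subtype.ext (Complex.exp_log z.2).symm))
  have hC' : ∀ s, expCover (C s) = c s := fun s => congrFun hC s
  obtain ⟨Δ, hΔ⟩ := h (C 1) ((hC' 1).trans c.target)
  let P : Path (C 0) (C 1) := ⟨C, rfl, rfl⟩
  let Q : Path (C 1 + k * (2 * Real.pi * Complex.I)) (C 0 + k * (2 * Real.pi * Complex.I)) :=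
    { toFun := fun s => P.symm s + k * (2 * Real.pi * Complex.I)
      continuous_toFun := by fun_prop
      source' := by simp
      target' := by simp }
  have hP : ∀ s, expCover (P s) = c s := hC'
  have hQ : ∀ s, expCover (Q s) = c.symm s := fun s =>
    Subtype.ext ((Complex.exp_eq_exp_iff_exists_int.2 ⟨k, rfl⟩).trans
      (congrArg Subtype.val (hC' (unitInterval.symm s))))
  refine windingNumber_eq_of_lift _ (P.trans (Δ.trans Q)) k rfl fun s => ?_
  simp only [Path.trans_apply]
  split_ifs <;> simp only [hP, hQ, hΔ]

/-! ### Arrangements -/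

open scoped LinearAlgebra.Projectivization

/-- A central arrangement of `n` (distinct) hyperplanes `H_i = ker α_i` in `ℂ^{ℓ+1}`, with an
ordering of the hyperplanes. -/
structure CentralArrangement (ℓ n : ℕ) where
  /-- the defining linear forms -/
  form : Fin n → Module.Dual ℂ (Fin (ℓ + 1) → ℂ)
  form_ne_zero : ∀ i, form i ≠ 0
  ker_injective : Function.Injective fun i => LinearMap.ker (form i)

/-- Complex projective space carries the quotient topology from `ℂ^{ℓ+1} ∖ {0}`. -/
instance projectiveSpaceTopology (ℓ : ℕ) : TopologicalSpace (ℙ ℂ (Fin (ℓ + 1) → ℂ)) :=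
  inferInstanceAs (TopologicalSpace (Quotient (projectivizationSetoid ℂ (Fin (ℓ + 1) → ℂ))))

namespace CentralArrangement

open LocalCoefficients

variable {ℓ n : ℕ} (A : CentralArrangement ℓ n)

/-- The complement `M` of the arrangement in `ℂ^{ℓ+1}`. -/
abbrev M : Type := {x : Fin (ℓ + 1) → ℂ // ∀ i, A.form i x ≠ 0}

/-- The complement `U` of the projectivized arrangement in `ℂℙ^ℓ`: the lines through the origin
that are not contained in any hyperplane of the arrangement. -/
abbrev U : Type := {x : ℙ ℂ (Fin (ℓ + 1) → ℂ) // ∀ i, ¬ x.submodule ≤ LinearMap.ker (A.form i)}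

lemma ne_zero_of_mem [NeZero n] (x : A.M) : x.1 ≠ 0 := fun h =>
  x.2 0 (by rw [h, map_zero])

/-- The restriction `M → U` of the Hopf map. -/
def hopf [NeZero n] : C(A.M, A.U) where
  toFun x := ⟨Projectivization.mk ℂ x.1 (A.ne_zero_of_mem x), fun i h => x.2 i (by
    rw [Projectivization.submodule_mk] at h
    exact h (Submodule.mem_span_singleton_self x.1))⟩
  continuous_toFun := by
    refine Continuous.subtype_mk ?_ _
    exact continuous_quotient_mk'.comp
      (Continuous.subtype_mk continuous_subtype_val fun x => A.ne_zero_of_mem x)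

/-- The form `α_i` as a map `M → ℂ ∖ {0}`. -/
def formMap (i : Fin n) : C(A.M, PuncturedPlane) where
  toFun x := ⟨A.form i x.1, x.2 i⟩
  continuous_toFun := Continuous.subtype_mk
    ((LinearMap.continuous_of_finiteDimensional (A.form i)).comp continuous_subtype_val) _

/-- The linking number of a loop in `M` with the hyperplane `H_i`. -/
def linkingNumber (x₀ : A.M) (i : Fin n) : FundamentalGroup A.M x₀ →* Multiplicative ℤ :=
  (windingNumber (A.formMap i x₀)).comp (FundamentalGroup.map (A.formMap i) x₀)

/-- The character of `π₁(M, x₀)` with parameter `t ∈ (Kˣ)ⁿ`: the composite of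
`π₁(M) → H₁(M) ≅ ℤⁿ` and the map that sends the `i`-th basis vector to `t_i`. Here `H₁(M) ≅ ℤⁿ`
takes the class of the meridian about `H_i` to the `i`-th basis vector, that is, it takes a loop
to the vector of its linking numbers with the hyperplanes (see `character_meridian`). -/
def character {K : Type u} [Field K] (x₀ : A.M) (t : Fin n → Kˣ) :
    FundamentalGroup A.M x₀ →* Kˣ :=
  ∏ i, (zpowersHom Kˣ (t i)).comp (A.linkingNumber x₀ i)

/-- A class in `π₁(M, x₀)` is a meridian about `H_i` if it runs along a path `c` from `x₀`, once
in the positive sense around the boundary of a disc `{p + z w : |z| ≤ 1}` that is transverse to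
`H_i` at its centre `p` and meets no other hyperplane, and back along `c`. -/
def IsMeridian (x₀ : A.M) (i : Fin n) (g : FundamentalGroup A.M x₀) : Prop :=
  ∃ p w : Fin (ℓ + 1) → ℂ, A.form i p = 0 ∧ A.form i w ≠ 0 ∧
    (∀ j, j ≠ i → ∀ z : ℂ, ‖z‖ ≤ 1 → A.form j (p + z • w) ≠ 0) ∧
    ∃ (b : A.M) (c : Path x₀ b) (δ : Path b b),
      (∀ s : unitInterval, (δ s).1 = p + Complex.exp (s * (2 * Real.pi * Complex.I)) • w) ∧
      g = Path.Homotopic.Quotient.mk (c.trans (δ.trans c.symm))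

lemma linkingNumber_meridian {x₀ : A.M} {i : Fin n} {g : FundamentalGroup A.M x₀}
    (hg : A.IsMeridian x₀ i g) (j : Fin n) :
    A.linkingNumber x₀ j g = Multiplicative.ofAdd (if j = i then 1 else 0) := by
  obtain ⟨p, w, hp, hw, hj, b, c, δ, hδ, rfl⟩ := hg
  have hform : ∀ s, A.form j (δ s).1 =
      A.form j p + Complex.exp (s * (2 * Real.pi * Complex.I)) * A.form j w := by
    intro s
    rw [hδ, map_add, map_smul, smul_eq_mul]
  have hb : A.form j b.1 = A.form j p + A.form j w := by
    have h := hform 0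
    simpa using h
  have hmap : FundamentalGroup.map (A.formMap j) x₀
      (Path.Homotopic.Quotient.mk (c.trans (δ.trans c.symm))) =
      Path.Homotopic.Quotient.mk ((c.map (A.formMap j).continuous).trans
        ((δ.map (A.formMap j).continuous).trans (c.map (A.formMap j).continuous).symm)) := by
    refine congrArg Path.Homotopic.Quotient.mk ?_
    exact (Path.map_trans c (δ.trans c.symm) _).trans
      (congrArg _ (Path.map_trans δ c.symm _))
  rw [linkingNumber, MonoidHom.comp_apply, hmap]
  refine windingNumber_conj _ _ _ fun e he => ?_
  have he' : Complex.exp e = A.form j p + A.form j w :=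
    (congrArg Subtype.val he).trans hb
  by_cases hji : j = i
  · subst hji
    refine ⟨⟨⟨fun s => e + s * (2 * Real.pi * Complex.I), by fun_prop⟩, by simp, by simp⟩,
      fun s => Subtype.ext ?_⟩
    change Complex.exp (e + s * (2 * Real.pi * Complex.I)) = A.form j (δ s).1
    rw [hform, Complex.exp_add, he', hp]
    ring
  · have ha : A.form j p ≠ 0 := by simpa using hj j hji 0 (by simp)
    have hlt : ‖A.form j w / A.form j p‖ < 1 := by
      by_contra hcon
      rw [not_lt, norm_div, one_le_div (norm_pos_iff.2 ha)] at hcon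
      have hw' : A.form j w ≠ 0 := norm_pos_iff.1 ((norm_pos_iff.2 ha).trans_le hcon)
      refine hj j hji (-(A.form j p / A.form j w)) ?_ ?_
      · rw [norm_neg, norm_div]
        exact div_le_one_of_le₀ hcon (norm_nonneg _)
      · rw [map_add, map_smul, smul_eq_mul]
        field_simp
        ring
    set r := A.form j w / A.form j p with hr
    have hrw : A.form j w = A.form j p * r := by rw [hr]; field_simp
    have hslit : ∀ s : ℝ,
        1 + Complex.exp (s * (2 * Real.pi * Complex.I)) * r ∈ Complex.slitPlane := by
      intro s
      refine Complex.mem_slitPlane_of_norm_lt_one ?_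
      rw [norm_mul, show (s : ℂ) * (2 * Real.pi * Complex.I) =
        ((s * (2 * Real.pi) : ℝ) : ℂ) * Complex.I by push_cast; ring,
        Complex.norm_exp_ofReal_mul_I, one_mul]
      exact hlt
    refine ⟨⟨⟨fun s => e + (Complex.log (1 + Complex.exp ((s : ℝ) *
      (2 * Real.pi * Complex.I)) * r) - Complex.log (1 + r)), ?_⟩, ?_, ?_⟩,
      fun s => Subtype.ext ?_⟩
    · refine continuous_const.add (Continuous.sub ?_ continuous_const)
      exact Continuous.clog (by fun_prop) fun s => hslit s
    · simp
    · simp [hji]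
    · have h0 : 1 + r ≠ 0 := by
        have h := Complex.slitPlane_ne_zero (hslit 0)
        simpa using h
      change Complex.exp (e + (Complex.log (1 + Complex.exp ((s : ℝ) *
        (2 * Real.pi * Complex.I)) * r) - Complex.log (1 + r))) = A.form j (δ s).1
      rw [hform, Complex.exp_add, Complex.exp_sub,
        Complex.exp_log (Complex.slitPlane_ne_zero (hslit s)), Complex.exp_log h0, he', hrw]
      field_simp

/-- The character with parameter `t` takes the value `t_i` on every meridian about `H_i`. -/
theorem character_meridian {K : Type u} [Field K] {x₀ : A.M} (t : Fin n → Kˣ) {i : Fin n}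
    {g : FundamentalGroup A.M x₀} (hg : A.IsMeridian x₀ i g) : A.character x₀ t g = t i := by
  simp only [character, MonoidHom.finsetProd_apply, MonoidHom.comp_apply,
    A.linkingNumber_meridian hg, zpowersHom_apply, toAdd_ofAdd]
  rw [Finset.prod_eq_single i]
  · simp
  · intro j _ hji
    simp [hji]
  · simp

/-! ### Characteristic varieties -/

variable (K : Type u) [Field K]

/-- The characteristic variety `Σ^q_d(M, K)`: the `t ∈ (Kˣ)ⁿ` with `dim H^q(M; K_t) ≥ d`. -/
def charVarM (x₀ : A.M) (q d : ℕ) : Set (Fin n → Kˣ) :=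
  {t | (d : Cardinal) ≤ Module.rank K (cohomology (rankOne (A.character x₀ t)) q)}

/-- The characteristic variety `Σ^q_d(U, K)`, as a subset of the kernel of the product map
`τ : (Kˣ)ⁿ → Kˣ`. For `τ(t) = 1` the local system `K_t` on `U` is that of the (unique) character
of `π₁(U)` whose composite with the surjection `π₁(M) → π₁(U)` induced by the Hopf map is the
character of `π₁(M)` with parameter `t`. -/
def charVarU [NeZero n] (x₀ : A.M) (q d : ℕ) : Set (Fin n → Kˣ) :=
  {t | ∏ i, t i = 1 ∧ ∃ χ : FundamentalGroup A.U (A.hopf x₀) →* Kˣ,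
    χ.comp (FundamentalGroup.map A.hopf x₀) = A.character x₀ t ∧
    (d : Cardinal) ≤ Module.rank K (cohomology (rankOne χ) q)}

end CentralArrangement

/-- The depth of a point `t` in a stratification `S 0 ⊇ S 1 ⊇ S 2 ⊇ ⋯`: the largest `d` with
`t ∈ S d` (`⊤` if there are arbitrarily large such `d`). -/
def depth {T : Type*} (S : ℕ → Set T) (t : T) : ℕ∞ :=
  ⨆ d ∈ {d : ℕ | t ∈ S d}, (d : ℕ∞)

end

noncomputable section

namespace CosimplicialHomotopy

open Simplicial SimplexCategory Opposite AlgebraicTopology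

variable {C : Type*} [Category* C]

/-- A cosimplicial homotopy, given by operators indexed by the simplices of the interval. -/
structure IntervalHomotopy {X Y : CosimplicialObject C} (f g : X ⟶ Y) where
  /-- the operator of a simplex `e : [m] ⟶ [1]` -/
  P {m : SimplexCategory} (e : m ⟶ ⦋1⦌) : X.obj m ⟶ Y.obj m
  naturality {m n : SimplexCategory} (θ : m ⟶ n) (e : n ⟶ ⦋1⦌) :
    X.map θ ≫ P e = P (θ ≫ e) ≫ Y.map θ
  P_zero (m : SimplexCategory) : P (const m ⦋1⦌ 0) = f.app m
  P_one (m : SimplexCategory) : P (const m ⦋1⦌ 1) = g.app m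

/-- The monotone map `[m] ⟶ [1]` that takes the value `0` exactly on the first `k` vertices. -/
def cut {m : ℕ} (k : ℕ) : ⦋m⦌ ⟶ ⦋1⦌ :=
  Hom.mk ⟨fun j => if j.val < k then 0 else 1, fun a b h => by
    have h' : a.val ≤ b.val := h
    dsimp only
    split_ifs
    · exact le_rfl
    · exact Fin.zero_le _
    · omega
    · exact le_rfl⟩

lemma cut_apply {m : ℕ} (k : ℕ) (j : Fin (m + 1)) :
    (cut k : ⦋m⦌ ⟶ ⦋1⦌).toOrderHom j = if j.val < k then 0 else 1 := rfl

lemma comp_cut_eq {m n : ℕ} (θ : ⦋m⦌ ⟶ ⦋n⦌) (k l : ℕ)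
    (h : ∀ j : Fin (m + 1), (θ.toOrderHom j).val < k ↔ j.val < l) :
    θ ≫ cut k = cut l := by
  ext j : 3
  change (cut k : ⦋n⦌ ⟶ ⦋1⦌).toOrderHom (θ.toOrderHom j) = (cut l : ⦋m⦌ ⟶ ⦋1⦌).toOrderHom j
  simp only [cut_apply, h]

lemma cut_zero {m : ℕ} : (cut 0 : ⦋m⦌ ⟶ ⦋1⦌) = const ⦋m⦌ ⦋1⦌ 1 := by
  ext j : 3
  rfl

lemma cut_of_lt {m k : ℕ} (h : m < k) : (cut k : ⦋m⦌ ⟶ ⦋1⦌) = const ⦋m⦌ ⦋1⦌ 0 := by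
  ext j : 3
  exact if_pos (j.isLt.trans_le h)

lemma δ_comp_cut {m : ℕ} (i : Fin (m + 2)) (k l : ℕ)
    (h : ∀ j : Fin (m + 1), (i.succAbove j).val < k ↔ j.val < l) :
    δ i ≫ cut k = cut l :=
  comp_cut_eq _ _ _ h

lemma σ_comp_cut {m : ℕ} (i : Fin (m + 1)) (k l : ℕ)
    (h : ∀ j : Fin (m + 2), (i.predAbove j).val < k ↔ j.val < l) :
    σ i ≫ cut k = cut l :=
  comp_cut_eq _ _ _ h

variable {X Y : CosimplicialObject C} {f g : X ⟶ Y} (H : IntervalHomotopy f g)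

/-- The prism operators of a homotopy. -/
def IntervalHomotopy.prism {n : ℕ} (i : Fin (n + 1)) : X.obj ⦋n + 1⦌ ⟶ Y.obj ⦋n⦌ :=
  H.P (cut (i.val + 1)) ≫ Y.map (σ i)

lemma IntervalHomotopy.map_comp_prism {m n : ℕ} (θ : ⦋m⦌ ⟶ ⦋n + 1⦌) (i : Fin (n + 1)) :
    X.map θ ≫ H.prism i = H.P (θ ≫ cut (i.val + 1)) ≫ Y.map (θ ≫ σ i) := by
  rw [prism, ← Category.assoc, H.naturality, Category.assoc, Y.map_comp]

lemma IntervalHomotopy.prism_comp_map {m n : ℕ} (θ : ⦋n⦌ ⟶ ⦋m⦌) (i : Fin (n + 1)) :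
    H.prism i ≫ Y.map θ = H.P (cut (i.val + 1)) ≫ Y.map (σ i ≫ θ) := by
  rw [prism, Category.assoc, Y.map_comp]

/-- The homotopy of simplicial objects in the opposite category. -/
def IntervalHomotopy.toSimplicial : SimplicialObject.Homotopy
    ((cosimplicialSimplicialEquiv C).functor.map f.op)
    ((cosimplicialSimplicialEquiv C).functor.map g.op) where
  h i := (H.prism i).op
  h_zero_comp_δ_zero n := by
    refine Quiver.Hom.unop_inj (Eq.trans (H.map_comp_prism (δ 0) (0 : Fin (n + 1))) ?_)
    rw [δ_comp_cut _ _ 0 (by simp), cut_zero, H.P_one]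
    refine (congrArg _ (congrArg _ (δ_comp_σ_self (i := (0 : Fin (n + 1)))))).trans ?_
    exact (congrArg _ (Y.map_id _)).trans (Category.comp_id _)
  h_last_comp_δ_last n := by
    refine Quiver.Hom.unop_inj
      (Eq.trans (H.map_comp_prism (δ (Fin.last (n + 1))) (Fin.last n)) ?_)
    rw [δ_comp_cut _ _ (n + 1) (by simp), cut_of_lt (by simp), H.P_zero]
    refine (congrArg _ (congrArg _ (δ_comp_σ_succ (i := Fin.last n)))).trans ?_
    exact (congrArg _ (Y.map_id _)).trans (Category.comp_id _)
  h_succ_comp_δ_castSucc_of_lt i j hij := by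
    refine Quiver.Hom.unop_inj ((H.map_comp_prism (δ i.castSucc) j.succ).trans
      (Eq.trans ?_ (H.prism_comp_map (δ i) j).symm))
    rw [δ_comp_cut _ _ (j.val + 1), δ_comp_σ_of_le hij]
    intro l
    rw [Fin.le_def] at hij
    simp only [Fin.succAbove, Fin.lt_def, Fin.val_castSucc, Fin.val_succ] at *
    split_ifs <;> simp <;> omega
  h_succ_comp_δ_castSucc_succ j := by
    refine Quiver.Hom.unop_inj ((H.map_comp_prism (δ j.castSucc.succ) j.succ).trans
      (Eq.trans ?_ (H.map_comp_prism (δ j.castSucc.succ) j.castSucc).symm))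
    rw [δ_comp_cut _ _ (j.val + 1), δ_comp_cut _ _ (j.val + 1), δ_comp_σ_succ]
    · rw [← Fin.castSucc_succ, δ_comp_σ_self]
    all_goals
      intro l
      simp only [Fin.succAbove, Fin.lt_def, Fin.val_castSucc, Fin.val_succ] at *
      split_ifs <;> simp <;> omega
  h_castSucc_comp_δ_succ_of_lt i j hji := by
    refine Quiver.Hom.unop_inj ((H.map_comp_prism (δ i.succ) j.castSucc).trans
      (Eq.trans ?_ (H.prism_comp_map (δ i) j).symm))
    rw [δ_comp_cut _ _ (j.val + 1), δ_comp_σ_of_gt hji]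
    intro l
    rw [Fin.lt_def] at hji
    simp only [Fin.succAbove, Fin.lt_def, Fin.val_castSucc, Fin.val_succ] at *
    split_ifs <;> simp <;> omega
  h_comp_σ_castSucc_of_le i j hij := by
    refine Quiver.Hom.unop_inj ((H.map_comp_prism (σ i.castSucc) j).trans
      (Eq.trans ?_ (H.prism_comp_map (σ i) j.succ).symm))
    rw [σ_comp_cut _ _ (j.val + 2), σ_comp_σ hij]
    · rfl
    intro l
    rw [Fin.le_def] at hij
    simp only [Fin.predAbove, Fin.lt_def, Fin.val_castSucc] at *
    split_ifs <;> simp <;> omega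
  h_comp_σ_succ_of_lt i j hji := by
    refine Quiver.Hom.unop_inj ((H.map_comp_prism (σ i.succ) j).trans
      (Eq.trans ?_ (H.prism_comp_map (σ i) j.castSucc).symm))
    rw [σ_comp_cut _ _ (j.val + 1), σ_comp_σ hji]
    · rfl
    intro l
    rw [Fin.le_def] at hji
    simp only [Fin.predAbove, Fin.lt_def, Fin.val_castSucc, Fin.val_succ] at *
    split_ifs <;> simp <;> omega

variable [Preadditive C]

lemma alternatingCofaceMapComplex_d (X : CosimplicialObject C) (n : ℕ) :
    ((alternatingCofaceMapComplex C).obj X).d n (n + 1) =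
      (((alternatingFaceMapComplex Cᵒᵖ).obj
        ((cosimplicialSimplicialEquiv C).functor.obj (op X))).d (n + 1) n).unop := by
  refine (CochainComplex.of_d _ _ _).trans ((AlternatingCofaceMapComplex.d_eq_unop_d X n).trans ?_)
  rw [alternatingFaceMapComplex_obj_d]

/-- The components of the homotopy of cochain maps. -/
def IntervalHomotopy.cochainHom (i j : ℕ) :
    ((alternatingCofaceMapComplex C).obj X).X i ⟶ ((alternatingCofaceMapComplex C).obj Y).X j :=
  (SimplicialObject.Homotopy.ToChainHomotopy.hom H.toSimplicial j i).unop

/-- A homotopy of cosimplicial maps induces a homotopy of cochain maps. -/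
def IntervalHomotopy.toCochainHomotopy :
    Homotopy ((alternatingCofaceMapComplex C).map f) ((alternatingCofaceMapComplex C).map g) where
  hom := H.cochainHom
  zero i j hij := by
    rw [cochainHom, SimplicialObject.Homotopy.ToChainHomotopy.hom_eq_zero _ _ _ hij]
    rfl
  comm n := by
    have h := congrArg Quiver.Hom.unop (H.toSimplicial.toChainHomotopy.comm n)
    cases n with
    | zero =>
      rw [dNext_eq_zero _ _ (by simp), prevD_eq (j' := 1) (w := by simp), zero_add] at h
      rw [prevD_eq_zero _ _ (by simp), dNext_eq (i' := 1) (w := by simp), add_zero,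
        alternatingCofaceMapComplex_d]
      exact h
    | succ n =>
      rw [dNext_eq (i' := n) (w := by simp), prevD_eq (j' := n + 2) (w := by simp)] at h
      rw [prevD_eq (j' := n) (w := by simp), dNext_eq (i' := n + 2) (w := by simp),
        alternatingCofaceMapComplex_d, alternatingCofaceMapComplex_d]
      exact h.trans (congrArg₂ _ (add_comm _ _) rfl)

end CosimplicialHomotopy

namespace CyclicCover

open Simplicial AlgebraicTopology LocalCoefficients CosimplicialHomotopy

/-- The period of the exponential. -/
abbrev period : ℂ := 2 * Real.pi * Complex.I

variable {K : Type u} [Field K] (C : CosimplicialObject (ModuleCat.{v} K))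

/-- The cohomology of a cosimplicial module, as a functor. -/
abbrev cohomologyFunctor (K : Type u) [Field K] (q : ℕ) :
    CosimplicialObject (ModuleCat.{v} K) ⥤ ModuleCat.{v} K :=
  alternatingCofaceMapComplex _ ⋙ HomologicalComplex.homologyFunctor _ _ q

/-- The translate of a singular simplex of `ℂ`. -/
def translate {n : SimplexCategory} (a : ℂ) (φ : C(Simplex n, ℂ)) : C(Simplex n, ℂ) :=
  φ + ContinuousMap.const _ a

lemma translate_apply {n : SimplexCategory} (a : ℂ) (φ : C(Simplex n, ℂ)) (x : Simplex n) :
    translate a φ x = φ x + a := rfl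

/-- The cochains on a product with `ℂ`: to a singular simplex of `ℂ`, a cochain. -/
def cylinder : CosimplicialObject (ModuleCat.{v} K) where
  obj n := ModuleCat.of K (C(Simplex n, ℂ) → C.obj n)
  map θ := ModuleCat.ofHom
    { toFun := fun d φ => (C.map θ).hom (d (φ.comp (simplexMap θ)))
      map_add' := fun _ _ => funext fun _ => map_add _ _ _
      map_smul' := fun _ _ => funext fun _ => map_smul _ _ _ }
  map_id n := by
    ext d φ
    change (C.map (𝟙 n)).hom (d (φ.comp (simplexMap (𝟙 n)))) = d φ
    rw [C.map_id, simplexMap_id, ContinuousMap.comp_id]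
    rfl
  map_comp {m n k} θ η := by
    ext d φ
    change (C.map (θ ≫ η)).hom (d (φ.comp (simplexMap (θ ≫ η)))) =
      (C.map η).hom ((C.map θ).hom (d ((φ.comp (simplexMap η)).comp (simplexMap θ))))
    rw [C.map_comp, simplexMap_comp, ContinuousMap.comp_assoc]
    rfl

/-- The pullback along the projection of a product with `ℂ`. -/
def pullback : C ⟶ cylinder C where
  app _ := ModuleCat.ofHom
    { toFun := fun c _ => c
      map_add' := fun _ _ => rfl
      map_smul' := fun _ _ => rfl }
  naturality _ _ _ := rfl

/-- The restriction to the slice over `0`. -/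
def slice : cylinder C ⟶ C where
  app _ := ModuleCat.ofHom
    { toFun := fun d => d 0
      map_add' := fun _ _ => rfl
      map_smul' := fun _ _ => rfl }
  naturality _ _ _ := rfl

/-- The difference of the weighted translation by a period and the identity. -/
def twist (t : K) : cylinder C ⟶ cylinder C where
  app n := ModuleCat.ofHom
    { toFun := fun d φ => t • d (translate period φ) - d φ
      map_add' := fun a b => funext fun φ => by
        simp only [Pi.add_apply, smul_add]
        abel
      map_smul' := fun r a => funext fun φ => by
        simp only [Pi.smul_apply, RingHom.id_apply, smul_sub, smul_comm t r] }
  naturality m n θ := by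
    ext d
    refine funext fun φ : C(Simplex n, ℂ) => ?_
    change t • (C.map θ).hom (d ((translate period φ).comp (simplexMap θ))) -
      (C.map θ).hom (d (φ.comp (simplexMap θ))) = (C.map θ).hom
        (t • d (translate period (φ.comp (simplexMap θ))) - d (φ.comp (simplexMap θ)))
    rw [map_sub, map_smul]
    rfl

/-- The cochains on the cylinder that are equivariant under translation by a period. -/
def equivariantSubmodule (t : K) (n : SimplexCategory) :
    Submodule K ((cylinder C).obj n) :=
  LinearMap.ker ((twist C t).app n).hom

lemma mem_equivariantSubmodule (t : K) (n : SimplexCategory) (d : C(Simplex n, ℂ) → C.obj n) :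
    d ∈ equivariantSubmodule C t n ↔ ∀ φ, t • d (translate period φ) = d φ := by
  change (fun φ => t • d (translate period φ) - d φ) = (0 : C(Simplex n, ℂ) → C.obj n) ↔ _
  simp only [funext_iff, Pi.zero_apply, sub_eq_zero]

/-- The cosimplicial module of equivariant cochains on the cylinder. -/
def equivariant (t : K) : CosimplicialObject (ModuleCat.{v} K) where
  obj n := ModuleCat.of K (equivariantSubmodule C t n)
  map θ := ModuleCat.ofHom (((cylinder C).map θ).hom.restrict fun d hd => by
    have h := ConcreteCategory.congr_hom ((twist C t).naturality θ) d
    refine h.trans ?_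
    change ((cylinder C).map θ).hom (((twist C t).app _).hom d) = 0
    rw [LinearMap.mem_ker.1 hd, map_zero])
  map_id n := by
    refine ModuleCat.hom_ext (LinearMap.ext fun d => Subtype.ext ?_)
    exact ConcreteCategory.congr_hom ((cylinder C).map_id n) d.1
  map_comp θ η := by
    refine ModuleCat.hom_ext (LinearMap.ext fun d => Subtype.ext ?_)
    exact ConcreteCategory.congr_hom ((cylinder C).map_comp θ η) d.1

/-- The inclusion of the equivariant cochains. -/
def equivariantIncl (t : K) : equivariant C t ⟶ cylinder C where
  app n := ModuleCat.ofHom (equivariantSubmodule C t n).subtype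
  naturality _ _ _ := rfl

lemma exists_sub_eq {V : Type*} [AddCommGroup V] (g : ℤ → V) :
    ∃ d : ℤ → V, ∀ m, d (m + 1) - d m = g m := by
  refine ⟨fun m => ∑ j ∈ Finset.Ico 0 m, g j - ∑ j ∈ Finset.Ico m 0, g j, fun m => ?_⟩
  beta_reduce
  rcases lt_or_ge m 0 with hm | hm
  · rw [Finset.Ico_eq_empty (by omega : ¬ (0 : ℤ) < m + 1),
      Finset.Ico_eq_empty (by omega : ¬ (0 : ℤ) < m),
      ← Finset.insert_Ico_add_one_left_eq_Ico hm, Finset.sum_insert (by simp)]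
    abel
  · rw [Finset.Ico_eq_empty (by omega : ¬ m < 0), Finset.Ico_eq_empty (by omega : ¬ m + 1 < 0),
      ← Finset.insert_Ico_right_eq_Ico_add_one hm, Finset.sum_insert (by simp)]
    abel

lemma exists_smul_sub_eq {V : Type*} [AddCommGroup V] [Module K V] {t : K} (ht : t ≠ 0)
    (g : ℤ → V) : ∃ d : ℤ → V, ∀ m, t • d (m + 1) - d m = g m := by
  obtain ⟨e, he⟩ := exists_sub_eq fun m => t ^ m • g m
  refine ⟨fun m => t ^ (-m) • e m, fun m => ?_⟩
  rw [smul_smul, ← zpow_one_add₀ ht, show 1 + -(m + 1) = -m by ring, ← smul_sub, he, smul_smul,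
    ← zpow_add₀ ht, neg_add_cancel, zpow_zero, one_smul]

/-- The number of the fundamental domain that contains the initial vertex. -/
def sheet {n : SimplexCategory} (φ : C(Simplex n, ℂ)) : ℤ :=
  ⌊(φ (initialVertex n)).im / (2 * Real.pi)⌋

lemma sheet_translate {n : SimplexCategory} (φ : C(Simplex n, ℂ)) :
    sheet (translate period φ) = sheet φ + 1 := by
  rw [sheet, sheet, ← Int.floor_add_one, translate_apply]
  congr 1
  have : (2 * Real.pi) ≠ 0 := by positivity
  simp only [period, Complex.add_im, Complex.mul_im, Complex.mul_re, Complex.re_ofNat,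
    Complex.ofReal_re, Complex.im_ofNat, Complex.ofReal_im, Complex.I_im, Complex.I_re]
  field_simp
  ring

lemma twist_surjective {t : K} (ht : t ≠ 0) (n : SimplexCategory)
    (g : C(Simplex n, ℂ) → C.obj n) :
    ∃ d : C(Simplex n, ℂ) → C.obj n, ∀ φ, t • d (translate period φ) - d φ = g φ := by
  choose e he using fun φ : C(Simplex n, ℂ) =>
    exists_smul_sub_eq ht fun m : ℤ => g (translate (m * period) φ)
  refine ⟨fun φ => e (translate (-(sheet φ * period)) φ) (sheet φ), fun φ => ?_⟩
  have h1 : translate (-((sheet φ + 1 : ℤ) * period)) (translate period φ) =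
      translate (-(sheet φ * period)) φ := by
    ext x
    simp only [translate_apply]
    push_cast
    ring
  have h2 : translate (sheet φ * period) (translate (-(sheet φ * period)) φ) = φ := by
    ext x
    simp only [translate_apply]
    ring
  have h := he (translate (-(sheet φ * period)) φ) (sheet φ)
  simp only [h2] at h
  simp only [sheet_translate, h1]
  exact h

/-- The short complex `0 → E → D → D → 0` of cochain complexes. -/
def wangComplex (t : K) : ShortComplex (CochainComplex (ModuleCat.{v} K) ℕ) where
  X₁ := (alternatingCofaceMapComplex _).obj (equivariant C t)
  X₂ := (alternatingCofaceMapComplex _).obj (cylinder C)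
  X₃ := (alternatingCofaceMapComplex _).obj (cylinder C)
  f := (alternatingCofaceMapComplex _).map (equivariantIncl C t)
  g := (alternatingCofaceMapComplex _).map (twist C t)
  zero := by
    ext n d
    exact d.2

lemma wangComplex_shortExact {t : K} (ht : t ≠ 0) : (wangComplex C t).ShortExact := by
  refine HomologicalComplex.shortExact_of_degreewise_shortExact _ fun n => ?_
  refine ModuleCat.shortComplex_shortExact _ ?_ ?_ ?_
  · intro d
    exact ⟨fun h => ⟨⟨d, h⟩, rfl⟩, fun ⟨e, he⟩ => he ▸ e.2⟩
  · exact Subtype.val_injective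
  · intro g
    obtain ⟨d, hd⟩ := twist_surjective C ht ⦋n⦌ g
    exact ⟨d, funext hd⟩

end CyclicCover

namespace CyclicCover

open Simplicial AlgebraicTopology LocalCoefficients CosimplicialHomotopy

variable {K : Type u} [Field K] (C : CosimplicialObject (ModuleCat.{v} K))

/-- The singular simplex of the unit interval given by a simplex of the standard interval. -/
def bump {m : SimplexCategory} (e : m ⟶ ⦋1⦌) : C(Simplex m, ℂ) :=
  ⟨fun x => ((simplexMap e x).1 1 : ℝ), by
    have h : Continuous fun x : Simplex m => (simplexMap e x).1 (1 : Fin 2) :=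
      (continuous_apply _).comp (continuous_subtype_val.comp (simplexMap e).continuous)
    exact Complex.continuous_ofReal.comp h⟩

lemma bump_comp {m n : SimplexCategory} (θ : m ⟶ n) (e : n ⟶ ⦋1⦌) :
    (bump e).comp (simplexMap θ) = bump (θ ≫ e) := by
  ext x
  simp only [bump, simplexMap_comp]
  rfl

lemma bump_const_zero (m : SimplexCategory) :
    bump (SimplexCategory.const m ⦋1⦌ 0) = 0 := by
  ext x
  change ((FunOnFinite.linearMap ℝ ℝ (fun _ : Fin (m.len + 1) => (0 : Fin 2)) x.1 1 : ℝ) : ℂ) = 0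
  simp [FunOnFinite.linearMap_apply_apply]

lemma bump_const_one (m : SimplexCategory) :
    bump (SimplexCategory.const m ⦋1⦌ 1) = 1 := by
  ext x
  change ((FunOnFinite.linearMap ℝ ℝ (fun _ : Fin (m.len + 1) => (1 : Fin 2)) x.1 1 : ℝ) : ℂ) = 1
  have h : ∑ i, x.1 i = 1 := x.2.2
  simp [h, FunOnFinite.linearMap_apply_apply]

/-- The straight-line contraction of `ℂ` gives a homotopy of cosimplicial maps. -/
def contraction : IntervalHomotopy (slice C ≫ pullback C) (𝟙 (cylinder C)) where
  P {m} e := ModuleCat.ofHom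
    { toFun := fun d φ => d (φ * bump e)
      map_add' := fun _ _ => rfl
      map_smul' := fun _ _ => rfl }
  naturality {m n} θ e := by
    ext d
    refine funext fun φ : C(Simplex n, ℂ) => ?_
    change (C.map θ).hom (d ((φ * bump e).comp (simplexMap θ))) =
      (C.map θ).hom (d (φ.comp (simplexMap θ) * bump (θ ≫ e)))
    rw [← bump_comp]
    rfl
  P_zero m := by
    ext d φ
    change d (φ * bump _) = d 0
    rw [bump_const_zero, mul_zero]
  P_one m := by
    ext d φ
    change d (φ * bump _) = d φ
    rw [bump_const_one, mul_one]

/-- The product with `ℂ` has the same cohomology. -/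
def pullbackIso (q : ℕ) :
    (cohomologyFunctor K q).obj C ≅ (cohomologyFunctor K q).obj (cylinder C) where
  hom := (cohomologyFunctor K q).map (pullback C)
  inv := (cohomologyFunctor K q).map (slice C)
  hom_inv_id := by
    rw [← Functor.map_comp, show pullback C ≫ slice C = 𝟙 C from rfl, CategoryTheory.Functor.map_id]
  inv_hom_id := by
    rw [← Functor.map_comp, ← CategoryTheory.Functor.map_id]
    exact (contraction C).toCochainHomotopy.homologyMap_eq q

/-- Multiplication by a scalar. -/
def scale (r : K) : C ⟶ C where
  app n := ModuleCat.ofHom (r • LinearMap.id)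
  naturality m n θ := by
    ext c
    exact (map_smul (C.map θ).hom r c).symm

lemma scale_comp_scale {r s : K} (h : s * r = 1) : scale C r ≫ scale C s = 𝟙 C := by
  ext n c
  change s • r • c = c
  rw [smul_smul, h, one_smul]

lemma pullback_comp_twist (t : K) :
    pullback C ≫ twist C t = scale C (t - 1) ≫ pullback C := by
  ext n c
  refine funext fun φ : C(Simplex n, ℂ) => ?_
  change t • c - c = (t - 1) • c
  rw [sub_smul, one_smul]

lemma twist_one_homology (q : ℕ) : (cohomologyFunctor K q).map (twist C 1) = 0 := by
  rw [← cancel_epi (pullbackIso C q).hom, Limits.comp_zero]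
  change (cohomologyFunctor K q).map (pullback C) ≫ _ = _
  rw [← Functor.map_comp]
  have : (alternatingCofaceMapComplex _).map (pullback C ≫ twist C 1) = 0 := by
    ext n c
    refine funext fun φ : C(Simplex ⦋n⦌, ℂ) => ?_
    change (1 : K) • c - c = 0
    rw [one_smul, sub_self]
  change HomologicalComplex.homologyMap ((alternatingCofaceMapComplex _).map _) q = 0
  exact (congrArg (HomologicalComplex.homologyMap · q) this).trans
    (HomologicalComplex.homologyMap_zero _ _ _)

lemma isIso_twist_homology {t : K} (ht : t ≠ 1) (q : ℕ) :
    IsIso ((cohomologyFunctor K q).map (twist C t)) := by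
  have ht' : t - 1 ≠ 0 := sub_ne_zero.2 ht
  have : IsIso (scale C (t - 1)) :=
    ⟨scale C (t - 1)⁻¹, scale_comp_scale C (inv_mul_cancel₀ ht'),
      scale_comp_scale C (mul_inv_cancel₀ ht')⟩
  have h : (cohomologyFunctor K q).map (twist C t) = (pullbackIso C q).inv ≫
      (cohomologyFunctor K q).map (scale C (t - 1)) ≫ (pullbackIso C q).hom := by
    rw [Iso.eq_inv_comp]
    change (cohomologyFunctor K q).map (pullback C) ≫ _ = _ ≫ (cohomologyFunctor K q).map _
    rw [← Functor.map_comp, ← Functor.map_comp, pullback_comp_twist]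
  rw [h]
  infer_instance

theorem rank_equivariant_one (q : ℕ) :
    Module.rank K ((cohomologyFunctor K (q + 1)).obj (equivariant C (1 : K))) =
      Module.rank K ((cohomologyFunctor K (q + 1)).obj C) +
        Module.rank K ((cohomologyFunctor K q).obj C) := by
  have hS := wangComplex_shortExact C (one_ne_zero (α := K))
  have hmono := (hS.homology_exact₃ q (q + 1) rfl).mono_g (twist_one_homology C q)
  have hepi := (hS.homology_exact₂ (q + 1)).epi_f (twist_one_homology C (q + 1))
  have h := ModuleCat.free_shortExact_rank_add
    (ShortComplex.ShortExact.mk' (hS.homology_exact₁ q (q + 1) rfl) hmono hepi)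
  refine h.trans ((add_comm _ _).trans ?_)
  exact congrArg₂ _ (pullbackIso C (q + 1)).toLinearEquiv.rank_eq.symm
    (pullbackIso C q).toLinearEquiv.rank_eq.symm

theorem rank_equivariant_of_ne_one {t : K} (ht0 : t ≠ 0) (ht : t ≠ 1) (q : ℕ) :
    Module.rank K ((cohomologyFunctor K (q + 1)).obj (equivariant C t)) = 0 := by
  have hS := wangComplex_shortExact C ht0
  have h1 := isIso_twist_homology C ht q
  have h2 := isIso_twist_homology C ht (q + 1)
  have e1 : hS.δ q (q + 1) rfl = 0 :=
    (hS.homology_exact₃ q (q + 1) rfl).epi_f_iff.1 (inferInstanceAs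
      (Epi ((cohomologyFunctor K q).map (twist C t))))
  have e2 : HomologicalComplex.homologyMap (wangComplex C t).f (q + 1) = 0 :=
    (hS.homology_exact₂ (q + 1)).mono_g_iff.1 (inferInstanceAs
      (Mono ((cohomologyFunctor K (q + 1)).map (twist C t))))
  have h := (hS.homology_exact₁ q (q + 1) rfl).isZero_X₂ e1 e2
  have : Subsingleton ((cohomologyFunctor K (q + 1)).obj (equivariant C t)) :=
    ModuleCat.subsingleton_of_isZero h
  exact rank_subsingleton' _ _

end CyclicCover

namespace LocalCoefficients

variable {K : Type u} [Field K] {X : Type w} [TopologicalSpace X]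

lemma LocalSystem.map_injective (L : LocalSystem.{u, v, w} K X) {x y : FundamentalGroupoid X}
    (p : x ⟶ y) : Function.Injective (L.map p).hom :=
  ((L.mapIso (asIso p)).toLinearEquiv).injective

lemma LocalSystem.map_surjective (L : LocalSystem.{u, v, w} K X) {x y : FundamentalGroupoid X}
    (p : x ⟶ y) : Function.Surjective (L.map p).hom :=
  ((L.mapIso (asIso p)).toLinearEquiv).surjective

/-- The class of a path between two points of a path connected space. -/
def slide {W : Type*} [TopologicalSpace W] [PathConnectedSpace W] (a b : W) :
    FundamentalGroupoid.mk a ⟶ FundamentalGroupoid.mk b :=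
  Path.Homotopic.Quotient.mk (PathConnectedSpace.somePath a b)

lemma hom_eq_of_simplyConnected {W : Type*} [TopologicalSpace W] [SimplyConnectedSpace W]
    {a b : FundamentalGroupoid W} (f g : a ⟶ b) : f = g :=
  Subsingleton.elim (α := Path.Homotopic.Quotient a.as b.as) f g

lemma map_heq_of_eq (L : LocalSystem.{u, v, w} K X) {W : Type*} [TopologicalSpace W]
    {g h : C(W, X)} (e : g = h) {a b : FundamentalGroupoid W} (p : a ⟶ b)
    {y : L.obj ((FundamentalGroupoid.map g).obj a)} {y' : L.obj ((FundamentalGroupoid.map h).obj a)}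
    (hy : HEq y y') :
    HEq ((L.map ((FundamentalGroupoid.map g).map p)).hom y)
      ((L.map ((FundamentalGroupoid.map h).map p)).hom y') := by
  subst e
  obtain rfl := eq_of_heq hy
  rfl

lemma map_eq_map_cast (L : LocalSystem.{u, v, w} K X) {a b c : X} (h : b = a) (p : Path a c)
    {y : L.obj ⟨a⟩} {y' : L.obj ⟨b⟩} (hy : HEq y y') :
    (L.map (X := ⟨a⟩) (Y := ⟨c⟩) (Path.Homotopic.Quotient.mk p)).hom y =
      (L.map (X := ⟨b⟩) (Y := ⟨c⟩) (Path.Homotopic.Quotient.mk (p.cast h rfl))).hom y' := by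
  subst h
  obtain rfl := eq_of_heq hy
  rfl

end LocalCoefficients

namespace CyclicCover

open Simplicial AlgebraicTopology LocalCoefficients CosimplicialHomotopy

/-- A map `X × ℂ → Y` that is the quotient by the translations by the multiples of the period of
the exponential, and through which singular simplices lift. -/
structure Covering (X Y : Type w) [TopologicalSpace X] [TopologicalSpace Y] where
  /-- the covering map -/
  map : C(X × ℂ, Y)
  map_add_period (x : X) (z : ℂ) : map (x, z + period) = map (x, z)
  eq_of_map_eq {x x' : X} {z z' : ℂ} (h : map (x, z) = map (x', z')) :
    x = x' ∧ ∃ k : ℤ, z' = z + k * period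
  exists_lift {n : SimplexCategory} (τ : C(Simplex n, Y)) :
    ∃ (σ : C(Simplex n, X)) (φ : C(Simplex n, ℂ)), map.comp (σ.prodMk φ) = τ

namespace Covering

variable {K : Type u} [Field K] {X Y : Type w} [TopologicalSpace X] [TopologicalSpace Y]
  (P : Covering X Y)

/-- The section over `0`. -/
def zeroSection : C(X, Y) := P.map.comp ((ContinuousMap.id X).prodMk (ContinuousMap.const X 0))

/-- The orbit map of a point. -/
def orbit (x : X) : C(ℂ, Y) := P.map.comp ((ContinuousMap.const ℂ x).prodMk (ContinuousMap.id ℂ))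

/-- The loop around the fibre direction. -/
def loop (x : X) : Path (P.zeroSection x) (P.zeroSection x) where
  toFun s := P.map (x, s * period)
  continuous_toFun := by fun_prop
  source' := by simp [zeroSection]
  target' := by
    have := P.map_add_period x 0
    rw [zero_add] at this
    simpa [zeroSection] using this

/-- The cylinder over a singular simplex. -/
def sweep {n : SimplexCategory} (σ : C(Simplex n, X)) : C(Simplex n × ℂ, Y) :=
  P.map.comp (σ.prodMap (ContinuousMap.id ℂ))

variable (L : LocalSystem.{u, v, w} K Y)

/-- The restriction of a local system to the section over `0`. -/
abbrev restriction : LocalSystem.{u, v, w} K X := FundamentalGroupoid.map P.zeroSection ⋙ L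

/-- The pullback of a cochain along the covering map, with values transported to the section
over `0`. -/
def unwind (n : SimplexCategory) :
    Cochain L n →ₗ[K] (C(Simplex n, ℂ) → Cochain (P.restriction L) n) :=
  LinearMap.pi fun φ => LinearMap.pi fun σ =>
    (L.map ((FundamentalGroupoid.map (P.sweep σ)).map
      (slide (initialVertex n, φ (initialVertex n)) (initialVertex n, 0)))).hom ∘ₗ
    LinearMap.proj (P.map.comp (σ.prodMk φ))

lemma unwind_apply {n : SimplexCategory} (c : Cochain L n) (φ : C(Simplex n, ℂ))
    (σ : C(Simplex n, X)) :
    P.unwind L n c φ σ = (L.map ((FundamentalGroupoid.map (P.sweep σ)).map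
      (slide (initialVertex n, φ (initialVertex n)) (initialVertex n, 0)))).hom
        (c (P.map.comp (σ.prodMk φ))) := rfl

lemma unwind_naturality {m n : SimplexCategory} (θ : m ⟶ n) (c : Cochain L m)
    (φ : C(Simplex n, ℂ)) :
    P.unwind L n (cochainMap L θ c) φ =
      cochainMap (P.restriction L) θ (P.unwind L m c (φ.comp (simplexMap θ))) := by
  funext σ
  have h1 := map_map_comp (FundamentalGroupoid.map (P.sweep σ)) L
    ((FundamentalGroupoid.map ((ContinuousMap.id (Simplex n)).prodMk φ)).map
      (simplexPath ((simplexMap θ) (initialVertex m)) (initialVertex n)))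
    (slide (initialVertex n, φ (initialVertex n)) (initialVertex n, 0))
    (c ((P.map.comp (σ.prodMk φ)).comp (simplexMap θ)))
  have h2 := map_map_comp (FundamentalGroupoid.map (P.sweep σ)) L
    ((FundamentalGroupoid.map ((simplexMap θ).prodMap (ContinuousMap.id ℂ))).map
      (slide (initialVertex m, φ (simplexMap θ (initialVertex m))) (initialVertex m, 0)))
    ((FundamentalGroupoid.map ((ContinuousMap.id (Simplex n)).prodMk
      (ContinuousMap.const (Simplex n) 0))).map
      (simplexPath ((simplexMap θ) (initialVertex m)) (initialVertex n)))
    (c ((P.map.comp (σ.prodMk φ)).comp (simplexMap θ)))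
  refine h1.symm.trans (Eq.trans ?_ h2)
  congr 4
  exact hom_eq_of_simplyConnected _ _

variable {L} {t : K}

lemma smul_map_loop_symm
    (hL : ∀ x (v : L.obj ⟨P.zeroSection x⟩),
      (L.map (X := ⟨_⟩) (Y := ⟨_⟩) (Path.Homotopic.Quotient.mk (P.loop x))).hom v = t • v)
    (x : X) (v : L.obj ⟨P.zeroSection x⟩) :
    t • (L.map (X := ⟨_⟩) (Y := ⟨_⟩) (Path.Homotopic.Quotient.mk (P.loop x).symm)).hom v = v := by
  rw [← map_smul, ← hL]
  let p : FundamentalGroupoid.mk (P.zeroSection x) ⟶ ⟨P.zeroSection x⟩ :=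
    Path.Homotopic.Quotient.mk (P.loop x)
  have h := map_map_comp (𝟭 _) L p (Groupoid.inv p) v
  rw [Groupoid.comp_inv] at h
  exact h.symm.trans (map_map_id (𝟭 _) L _ v)

/-- The straight path from the period to `0`. -/
def periodPath : Path (0 + period) 0 where
  toFun s := unitInterval.symm s * period
  continuous_toFun := by fun_prop
  source' := by simp
  target' := by simp

lemma smul_unwind_translate
    (hL : ∀ x (v : L.obj ⟨P.zeroSection x⟩),
      (L.map (X := ⟨_⟩) (Y := ⟨_⟩) (Path.Homotopic.Quotient.mk (P.loop x))).hom v = t • v)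
    {n : SimplexCategory} (c : Cochain L n) (φ : C(Simplex n, ℂ)) :
    t • P.unwind L n c (translate period φ) = P.unwind L n c φ := by
  funext σ
  change t • P.unwind L n c (translate period φ) σ = P.unwind L n c φ σ
  rw [unwind_apply, unwind_apply]
  set v₀ := initialVertex n
  set x := σ v₀
  set a := φ v₀
  let ι : C(ℂ, Simplex n × ℂ) := (ContinuousMap.const ℂ v₀).prodMk (ContinuousMap.id ℂ)
  let shift : C(ℂ, ℂ) := ⟨fun z => z + period, by fun_prop⟩
  have hcomp : P.map.comp (σ.prodMk (translate period φ)) = P.map.comp (σ.prodMk φ) := by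
    ext y
    exact P.map_add_period (σ y) (φ y)
  have hshift : (P.orbit x).comp shift = P.orbit x := by
    ext z
    exact P.map_add_period x z
  have hc : HEq (c (P.map.comp (σ.prodMk (translate period φ))))
      (c (P.map.comp (σ.prodMk φ))) := by
    rw [hcomp]
  have e1 : slide (v₀, a) (v₀, (0 : ℂ)) = (FundamentalGroupoid.map ι).map (slide a 0) :=
    hom_eq_of_simplyConnected _ _
  have e2 : slide (v₀, a + period) (v₀, (0 : ℂ)) =
      (FundamentalGroupoid.map ι).map ((FundamentalGroupoid.map shift).map (slide a 0)) ≫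
        (FundamentalGroupoid.map ι).map (X := ⟨0 + period⟩) (Y := ⟨0⟩)
          (Path.Homotopic.Quotient.mk periodPath) :=
    hom_eq_of_simplyConnected _ _
  have h2 := (congrArg (fun p : FundamentalGroupoid.mk (v₀, a + period) ⟶ ⟨(v₀, 0)⟩ => (L.map ((FundamentalGroupoid.map (P.sweep σ)).map p)).hom
    (c (P.map.comp (σ.prodMk (translate period φ))))) e2).trans
    (map_map_comp (FundamentalGroupoid.map (P.sweep σ)) L
    ((FundamentalGroupoid.map ι).map ((FundamentalGroupoid.map shift).map (slide a 0)))
    ((FundamentalGroupoid.map ι).map (X := ⟨0 + period⟩) (Y := ⟨0⟩)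
          (Path.Homotopic.Quotient.mk periodPath)) _)
  have h1 := congrArg (fun p : FundamentalGroupoid.mk (v₀, a) ⟶ ⟨(v₀, 0)⟩ => (L.map ((FundamentalGroupoid.map (P.sweep σ)).map p)).hom
    (c (P.map.comp (σ.prodMk φ)))) e1
  refine (congrArg (t • ·) h2).trans (Eq.trans ?_ h1.symm)
  have hw := map_heq_of_eq L hshift (slide a 0) hc
  have hpt : P.zeroSection x = P.orbit x (0 + period) := (P.map_add_period x 0).symm
  have h3 := map_eq_map_cast L hpt (periodPath.map (P.orbit x).continuous) hw
  have h4 := P.smul_map_loop_symm hL x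
    ((L.map ((FundamentalGroupoid.map (P.orbit x)).map (slide a 0))).hom
      (c (P.map.comp (σ.prodMk φ))))
  exact (congrArg (t • ·) h3).trans h4

end Covering

end CyclicCover

namespace CyclicCover

open Simplicial AlgebraicTopology LocalCoefficients CosimplicialHomotopy

lemma translate_translate {n : SimplexCategory} (a b : ℂ) (φ : C(Simplex n, ℂ)) :
    translate a (translate b φ) = translate (b + a) φ := by
  ext x
  simp only [translate_apply, add_assoc]

lemma smul_translate_zpow {K : Type u} [Field K] {n : SimplexCategory} {V : Type*}
    [AddCommGroup V] [Module K V] {t : K} (ht : t ≠ 0) {d : C(Simplex n, ℂ) → V}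
    (hd : ∀ φ, t • d (translate period φ) = d φ) (k : ℤ) (φ : C(Simplex n, ℂ)) :
    t ^ k • d (translate (k * period) φ) = d φ := by
  have key (k : ℤ) : t ^ (k + 1) • d (translate ((k + 1 : ℤ) * period) φ) =
      t ^ k • d (translate (k * period) φ) := by
    rw [zpow_add_one₀ ht, mul_smul, ← hd (translate (k * period) φ), translate_translate]
    push_cast
    rw [add_mul, one_mul]
  induction k using Int.induction_on with
  | zero =>
    rw [zpow_zero, one_smul]
    congr 1
    ext x
    simp [translate_apply]
  | succ k ih => rw [key, ih]
  | pred k ih =>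
    rw [← key, show -(k : ℤ) - 1 + 1 = -(k : ℤ) by ring, ih]

namespace Covering

variable {K : Type u} [Field K] {X Y : Type w} [TopologicalSpace X] [TopologicalSpace Y]
  (P : Covering X Y)

lemma eq_translate_of_comp_eq {n : SimplexCategory} {σ σ' : C(Simplex n, X)}
    {φ φ' : C(Simplex n, ℂ)} (h : P.map.comp (σ.prodMk φ) = P.map.comp (σ'.prodMk φ')) :
    σ = σ' ∧ ∃ k : ℤ, φ' = translate (k * period) φ := by
  have hx (x : Simplex n) := P.eq_of_map_eq (DFunLike.congr_fun h x)
  refine ⟨ContinuousMap.ext fun x => (hx x).1, ?_⟩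
  choose k hk using fun x => (hx x).2
  have hp : period ≠ 0 := Complex.two_pi_I_ne_zero
  have hk' (x) : (k x : ℂ) = (φ' x - φ x) / period := by
    rw [eq_div_iff hp]
    exact eq_sub_of_add_eq' (hk x).symm
  have hcont : Continuous k := by
    rw [(Int.isClosedEmbedding_coe_real).isEmbedding.continuous_iff]
    have : Continuous fun x => ((φ' x - φ x) / period).re := by fun_prop
    refine this.congr fun x => ?_
    rw [← hk' x]
    simp
  refine ⟨k (initialVertex n), ContinuousMap.ext fun x => ?_⟩
  have hpre : PreconnectedSpace (Simplex n) := inferInstance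
  rw [PreconnectedSpace.constant hpre hcont (x := initialVertex n) (y := x)]
  exact hk x

variable {L : LocalSystem.{u, v, w} K Y} {t : K}

lemma unwind_injective (n : SimplexCategory) : Function.Injective (P.unwind L n) := by
  rw [injective_iff_map_eq_zero]
  intro c hc
  funext τ
  obtain ⟨σ, φ, rfl⟩ := P.exists_lift τ
  have h := congrFun (congrFun hc φ) σ
  rw [unwind_apply] at h
  exact L.map_injective _ (h.trans (map_zero _).symm)

lemma exists_unwind_eq (ht : t ≠ 0)
    (hL : ∀ x (v : L.obj ⟨P.zeroSection x⟩),
      (L.map (X := ⟨_⟩) (Y := ⟨_⟩) (Path.Homotopic.Quotient.mk (P.loop x))).hom v = t • v)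
    {n : SimplexCategory} (d : C(Simplex n, ℂ) → Cochain (P.restriction L) n)
    (hd : ∀ φ, t • d (translate period φ) = d φ) :
    ∃ c, P.unwind L n c = d := by
  classical
  have key (τ : C(Simplex n, Y)) : ∃ c : Cochain L n, ∀ σ φ, P.map.comp (σ.prodMk φ) = τ →
      P.unwind L n c φ σ = d φ σ := by
    obtain ⟨σ, φ, rfl⟩ := P.exists_lift τ
    obtain ⟨y, hy⟩ := L.map_surjective ((FundamentalGroupoid.map (P.sweep σ)).map
      (slide (initialVertex n, φ (initialVertex n)) (initialVertex n, 0))) (d φ σ)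
    let c : Cochain L n := Function.update 0 (P.map.comp (σ.prodMk φ)) y
    have hc : P.unwind L n c φ σ = d φ σ := by
      rw [unwind_apply, ← hy]
      exact congrArg _ (Function.update_self _ _ _)
    refine ⟨c, fun σ' φ' h => ?_⟩
    obtain ⟨rfl, k, rfl⟩ := P.eq_translate_of_comp_eq h.symm
    refine smul_right_injective _ (zpow_ne_zero k ht) ?_
    have e1 := congrFun (smul_translate_zpow ht (P.smul_unwind_translate hL c) k φ) σ
    have e2 := congrFun (smul_translate_zpow ht hd k φ) σ
    exact e1.trans (hc.trans e2.symm)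
  choose c hc using key
  refine ⟨fun τ => c τ τ, funext fun φ => funext fun σ => ?_⟩
  exact hc _ σ φ rfl

/-- The cochains on `Y` are the equivariant cochains on `X × ℂ`. -/
def unwindEquiv (ht : t ≠ 0)
    (hL : ∀ x (v : L.obj ⟨P.zeroSection x⟩),
      (L.map (X := ⟨_⟩) (Y := ⟨_⟩) (Path.Homotopic.Quotient.mk (P.loop x))).hom v = t • v)
    (n : SimplexCategory) :
    Cochain L n ≃ₗ[K] equivariantSubmodule (cochains (P.restriction L)) t n :=
  LinearEquiv.ofBijective ((P.unwind L n).codRestrict _ fun c =>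
    (mem_equivariantSubmodule _ _ _ _).2 (P.smul_unwind_translate hL c)) (by
    refine ⟨fun a b h => P.unwind_injective n (congrArg Subtype.val h), fun d => ?_⟩
    obtain ⟨c, hc⟩ := P.exists_unwind_eq ht hL d.1 ((mem_equivariantSubmodule _ _ _ _).1 d.2)
    exact ⟨c, Subtype.ext hc⟩)

/-- The cosimplicial module of cochains on `Y` is that of equivariant cochains on `X × ℂ`. -/
def cochainsIso (ht : t ≠ 0)
    (hL : ∀ x (v : L.obj ⟨P.zeroSection x⟩),
      (L.map (X := ⟨_⟩) (Y := ⟨_⟩) (Path.Homotopic.Quotient.mk (P.loop x))).hom v = t • v) :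
    cochains L ≅ equivariant (cochains (P.restriction L)) t :=
  NatIso.ofComponents (fun n => (P.unwindEquiv ht hL n).toModuleIso) fun {m n} θ => by
    refine ModuleCat.hom_ext (LinearMap.ext fun c => Subtype.ext ?_)
    exact funext fun φ => P.unwind_naturality L θ c φ

theorem rank_cohomology_of_trivial
    (hL : ∀ x (v : L.obj ⟨P.zeroSection x⟩),
      (L.map (X := ⟨_⟩) (Y := ⟨_⟩) (Path.Homotopic.Quotient.mk (P.loop x))).hom v = v) (q : ℕ) :
    Module.rank K (cohomology L (q + 1)) =
      Module.rank K (cohomology (P.restriction L) (q + 1)) +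
        Module.rank K (cohomology (P.restriction L) q) := by
  have hL' : ∀ x (v : L.obj ⟨P.zeroSection x⟩), (L.map (X := ⟨_⟩) (Y := ⟨_⟩)
      (Path.Homotopic.Quotient.mk (P.loop x))).hom v = (1 : K) • v := fun x v => by
    rw [hL, one_smul]
  exact ((cohomologyFunctor K (q + 1)).mapIso
    (P.cochainsIso one_ne_zero hL')).toLinearEquiv.rank_eq.trans
      (rank_equivariant_one (cochains (P.restriction L)) q)

theorem rank_cohomology_of_ne_one (ht0 : t ≠ 0) (ht : t ≠ 1)
    (hL : ∀ x (v : L.obj ⟨P.zeroSection x⟩),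
      (L.map (X := ⟨_⟩) (Y := ⟨_⟩) (Path.Homotopic.Quotient.mk (P.loop x))).hom v = t • v)
    (q : ℕ) : Module.rank K (cohomology L (q + 1)) = 0 :=
  ((cohomologyFunctor K (q + 1)).mapIso (P.cochainsIso ht0 hL)).toLinearEquiv.rank_eq.trans
    (rank_equivariant_of_ne_one (cochains (P.restriction L)) ht0 ht q)

end Covering

end CyclicCover

namespace LocalCoefficients

variable {K : Type u} [Field K] {X : Type w} [TopologicalSpace X]

/-- Isomorphic local systems have isomorphic cochains. -/
def cochainsMapIso {L L' : LocalSystem.{u, v, w} K X} (e : L ≅ L') : cochains L ≅ cochains L' :=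
  NatIso.ofComponents (fun n => (LinearEquiv.piCongrRight fun σ : C(Simplex n, X) =>
      (e.app ⟨σ (initialVertex n)⟩).toLinearEquiv).toModuleIso) fun {m n} θ => by
    refine ModuleCat.hom_ext (LinearMap.ext fun c => funext fun σ => ?_)
    exact ConcreteCategory.congr_hom (e.hom.naturality _) (c (σ.comp (simplexMap θ)))

theorem rank_cohomology_eq_of_iso {L L' : LocalSystem.{u, v, w} K X} (e : L ≅ L') (q : ℕ) :
    Module.rank K (cohomology L q) = Module.rank K (cohomology L' q) :=
  ((CyclicCover.cohomologyFunctor K q).mapIso (cochainsMapIso e)).toLinearEquiv.rank_eq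

end LocalCoefficients

namespace LocalCoefficients

variable {K : Type u} [Field K] {X : Type w} [TopologicalSpace X]

lemma rankOneFibre_apply {x₀ : X} {ρ : FundamentalGroup X x₀ →* Kˣ} {x : FundamentalGroupoid X}
    (f : rankOneFibre ρ x) (γ γ' : FundamentalGroupoid.mk x₀ ⟶ x) :
    f.1 γ' = (ρ (FundamentalGroup.fromArrow (γ' ≫ Groupoid.inv γ)) : K) * f.1 γ := by
  have e : γ' = (γ' ≫ Groupoid.inv γ) ≫ γ := by
    rw [Category.assoc, Groupoid.inv_comp, Category.comp_id]
  exact (congrArg f.1 e).trans (f.2 _ γ)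

variable {X' : Type w} [TopologicalSpace X']

lemma map_comp_inv (g : C(X', X)) {x y z : FundamentalGroupoid X'} (p : x ⟶ y) (q : z ⟶ y) :
    (FundamentalGroupoid.map g).map (p ≫ Groupoid.inv q) =
      (FundamentalGroupoid.map g).map p ≫ Groupoid.inv ((FundamentalGroupoid.map g).map q) := by
  rw [Functor.map_comp, Groupoid.inv_eq_inv, Groupoid.inv_eq_inv, Functor.map_inv]

/-- The pullback of the fibres of a rank one local system. -/
def rankOneFibreComap (g : C(X', X)) {x₀ : X'} (χ : FundamentalGroup X (g x₀) →* Kˣ)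
    {ρ : FundamentalGroup X' x₀ →* Kˣ} (h : χ.comp (FundamentalGroup.map g x₀) = ρ)
    (x : FundamentalGroupoid X') :
    rankOneFibre χ ((FundamentalGroupoid.map g).obj x) →ₗ[K] rankOneFibre ρ x where
  toFun f := ⟨fun γ => f.1 ((FundamentalGroupoid.map g).map γ), fun a γ => by
    rw [← h]
    exact (congrArg f.1 ((FundamentalGroupoid.map g).map_comp a.toArrow γ)).trans
      (f.2 (FundamentalGroup.map g x₀ a) _)⟩
  map_add' _ _ := rfl
  map_smul' _ _ := rfl

lemma rankOneFibreComap_bijective [PathConnectedSpace X'] (g : C(X', X)) {x₀ : X'}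
    (χ : FundamentalGroup X (g x₀) →* Kˣ) {ρ : FundamentalGroup X' x₀ →* Kˣ}
    (h : χ.comp (FundamentalGroup.map g x₀) = ρ) (x : FundamentalGroupoid X') :
    Function.Bijective (rankOneFibreComap g χ h x) := by
  subst h
  let γ : FundamentalGroupoid.mk x₀ ⟶ x := slide x₀ x.as
  let γ' : FundamentalGroupoid.mk (g x₀) ⟶ (FundamentalGroupoid.map g).obj x :=
    (FundamentalGroupoid.map g).map γ
  constructor
  · intro a b hab
    have h0 : a.1 γ' = b.1 γ' := congrFun (congrArg Subtype.val hab) γ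
    refine Subtype.ext (funext fun δ => ?_)
    rw [rankOneFibre_apply a γ' δ, rankOneFibre_apply b γ' δ, h0]
  · intro f
    refine ⟨⟨fun δ => (χ (FundamentalGroup.fromArrow (δ ≫ Groupoid.inv γ')) : K) * f.1 γ,
      fun a δ => ?_⟩, Subtype.ext (funext fun δ => ?_)⟩
    · have e : FundamentalGroup.fromArrow ((a.toArrow ≫ δ) ≫ Groupoid.inv γ') =
          FundamentalGroup.fromArrow (δ ≫ Groupoid.inv γ') * a := Category.assoc _ _ _
      beta_reduce
      rw [e, map_mul, mul_comm (χ _), Units.val_mul, mul_assoc]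
    · rw [rankOneFibre_apply f γ δ]
      exact congrArg (fun a : FundamentalGroupoid.mk (g x₀) ⟶ ⟨g x₀⟩ =>
        (χ (FundamentalGroup.fromArrow a) : K) * f.1 γ) (map_comp_inv g δ γ).symm

/-- The pullback of the local system of a character is that of the pullback of the character. -/
def rankOneComapIso [PathConnectedSpace X'] (g : C(X', X)) {x₀ : X'}
    (χ : FundamentalGroup X (g x₀) →* Kˣ) {ρ : FundamentalGroup X' x₀ →* Kˣ}
    (h : χ.comp (FundamentalGroup.map g x₀) = ρ) :
    FundamentalGroupoid.map g ⋙ (rankOne χ : LocalSystem.{u, max u w, w} K X) ≅ rankOne ρ :=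
  NatIso.ofComponents (fun x => (LinearEquiv.ofBijective (rankOneFibreComap g χ h x)
      (rankOneFibreComap_bijective g χ h x)).toModuleIso) fun {x y} p => by
    refine ModuleCat.hom_ext (LinearMap.ext fun f => Subtype.ext (funext fun γ => ?_))
    exact (congrArg f.1 (map_comp_inv g γ p)).symm

/-- The monodromy of the local system of a character along a loop. -/
lemma rankOne_map_loop [PathConnectedSpace X] {x₀ x : X} (ρ : FundamentalGroup X x₀ →* Kˣ)
    (δ : Path x x) (t : Kˣ)
    (h : ∀ c : Path x₀ x, ρ (FundamentalGroup.fromPath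
      (Path.Homotopic.Quotient.mk (c.trans (δ.trans c.symm)))) = t)
    (f : (rankOne ρ : LocalSystem.{u, max u w, w} K X).obj ⟨x⟩) :
    ((rankOne ρ).map (X := ⟨x⟩) (Y := ⟨x⟩) (Path.Homotopic.Quotient.mk δ)).hom f =
      ((t⁻¹ : Kˣ) : K) • f := by
  refine Subtype.ext (funext fun γ => ?_)
  induction γ using Quotient.inductionOn with | _ c =>
  let γ : FundamentalGroupoid.mk x₀ ⟶ ⟨x⟩ := Path.Homotopic.Quotient.mk c
  let d : FundamentalGroupoid.mk x ⟶ ⟨x⟩ := Path.Homotopic.Quotient.mk δ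
  change f.1 (γ ≫ Groupoid.inv d) = ((t⁻¹ : Kˣ) : K) * f.1 γ
  have key : f.1 γ = (t : K) * f.1 (γ ≫ Groupoid.inv d) := by
    have e : γ ≫ Groupoid.inv (γ ≫ Groupoid.inv d) = γ ≫ d ≫ Groupoid.inv γ := by
      simp [Groupoid.inv_eq_inv]
    have h' : ρ (FundamentalGroup.fromArrow (γ ≫ d ≫ Groupoid.inv γ)) = t := h c
    rw [← h', ← e]
    exact rankOneFibre_apply f (γ ≫ Groupoid.inv d) γ
  rw [key, ← mul_assoc, Units.inv_mul, one_mul]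

end LocalCoefficients

lemma exists_winding_lift {z : PuncturedPlane} (γ : Path z z) :
    ∃ (e e' : ℂ) (Γ : Path e e') (k : ℤ), e' = e + k * (2 * Real.pi * Complex.I) ∧
      ∀ s, expCover (Γ s) = γ s := by
  obtain ⟨Γ, hΓ, -⟩ := isAddQuotientCoveringMap_expCover.isCoveringMap.exists_path_lifts
    γ.toContinuousMap (Complex.log z.1)
    (γ.source.trans (Subtype.ext (Complex.exp_log z.2).symm))
  have hΓ' : ∀ s, expCover (Γ s) = γ s := fun s => congrFun hΓ s
  have h : Complex.exp (Γ 1) = Complex.exp (Γ 0) := by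
    have h1 := congrArg Subtype.val ((hΓ' 1).trans γ.target)
    have h0 := congrArg Subtype.val ((hΓ' 0).trans γ.source)
    exact h1.trans h0.symm
  obtain ⟨k, hk⟩ := Complex.exp_eq_exp_iff_exists_int.1 h
  exact ⟨Γ 0, Γ 1, ⟨Γ, rfl, rfl⟩, k, hk, hΓ'⟩

lemma windingNumber_div {a b c : PuncturedPlane} (α : Path a a) (β : Path b b) (γ : Path c c)
    (h : ∀ s, (γ s).1 = (β s).1⁻¹ * (α s).1) :
    windingNumber c (Path.Homotopic.Quotient.mk γ) =
      windingNumber a (Path.Homotopic.Quotient.mk α) /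
        windingNumber b (Path.Homotopic.Quotient.mk β) := by
  obtain ⟨e, e', Γ, k, he, hΓ⟩ := exists_winding_lift α
  obtain ⟨f, f', Δ, l, hf, hΔ⟩ := exists_winding_lift β
  rw [windingNumber_eq_of_lift α Γ k he hΓ, windingNumber_eq_of_lift β Δ l hf hΔ, ← ofAdd_sub]
  let Λ : Path (e - f) (e' - f') :=
    { toFun := fun s => Γ s - Δ s
      continuous_toFun := by fun_prop
      source' := by simp
      target' := by simp }
  refine windingNumber_eq_of_lift γ Λ (k - l) ?_ fun s => Subtype.ext ?_
  · rw [he, hf]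
    push_cast
    ring
  · have h1 : Complex.exp (Γ s) = (α s).1 := congrArg Subtype.val (hΓ s)
    have h2 : Complex.exp (Δ s) = (β s).1 := congrArg Subtype.val (hΔ s)
    change Complex.exp (Γ s - Δ s) = _
    rw [h, ← h1, ← h2, Complex.exp_sub, div_eq_inv_mul]

/-- Singular simplices of the punctured plane have logarithms. -/
lemma exists_log_simplex {n : SimplexCategory} (f : C(LocalCoefficients.Simplex n, ℂ))
    (hf : ∀ x, f x ≠ 0) :
    ∃ φ : C(LocalCoefficients.Simplex n, ℂ), ∀ x, Complex.exp (φ x) = f x := by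
  have : LocallyPathConnectedSpace (LocalCoefficients.Simplex n) :=
    (convex_stdSimplex ℝ (Fin (n.len + 1))).locallyPathConnectedSpace
  let g : C(LocalCoefficients.Simplex n, PuncturedPlane) :=
    ⟨fun x => ⟨f x, hf x⟩, by fun_prop⟩
  let v := LocalCoefficients.initialVertex n
  obtain ⟨φ, ⟨-, hφ⟩, -⟩ :=
    isAddQuotientCoveringMap_expCover.isCoveringMap.existsUnique_continuousMap_lifts g v
      (Complex.log (f v)) (Subtype.ext (Complex.exp_log (hf v)))
  exact ⟨φ, fun x => congrArg Subtype.val (congrFun hφ x)⟩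

lemma Cardinal.natCast_le_add_iff {a b : Cardinal.{u}} {d : ℕ} :
    (d : Cardinal) ≤ a + b ↔ ∃ j ≤ d, ((d - j : ℕ) : Cardinal) ≤ a ∧ (j : Cardinal) ≤ b := by
  constructor
  · intro h
    rcases lt_or_ge a Cardinal.aleph0 with ha | ha
    · rcases lt_or_ge b Cardinal.aleph0 with hb | hb
      · obtain ⟨m, rfl⟩ := Cardinal.lt_aleph0.1 ha
        obtain ⟨k, rfl⟩ := Cardinal.lt_aleph0.1 hb
        have h' : d ≤ m + k := by exact_mod_cast h
        refine ⟨min d k, min_le_left _ _, ?_, ?_⟩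
        · have : d - min d k ≤ m := by omega
          exact_mod_cast this
        · have : min d k ≤ k := min_le_right _ _
          exact_mod_cast this
      · exact ⟨d, le_rfl, by simp, (Cardinal.natCast_lt_aleph0).le.trans hb⟩
    · exact ⟨0, Nat.zero_le _, (Cardinal.natCast_lt_aleph0).le.trans ha, by simp⟩
  · rintro ⟨j, hj, ha, hb⟩
    calc (d : Cardinal) = ((d - j : ℕ) : Cardinal) + j := by
          rw [← Nat.cast_add, Nat.sub_add_cancel hj]
      _ ≤ a + b := add_le_add ha hb

lemma depth_eq_toENat {T : Type*} (S : ℕ → Set T) (t : T) (r : Cardinal.{u})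
    (h : ∀ d : ℕ, t ∈ S d ↔ (d : Cardinal) ≤ r) : depth S t = Cardinal.toENat r := by
  refine le_antisymm (iSup₂_le fun d hd => Cardinal.natCast_le_toENat.2 ((h d).1 hd)) ?_
  refine ENat.forall_natCast_le_iff_le.1 fun d hd => ?_
  exact le_iSup₂ (f := fun (d : ℕ) (_ : d ∈ {d : ℕ | t ∈ S d}) => (d : ℕ∞)) d
    ((h d).2 (Cardinal.natCast_le_toENat.1 hd))

namespace CentralArrangement

open LocalCoefficients CyclicCover
open scoped LinearAlgebra.Projectivization

variable {ℓ n : ℕ} (A : CentralArrangement ℓ n)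

lemma continuous_form (i : Fin n) : Continuous (A.form i) :=
  LinearMap.continuous_of_finiteDimensional (A.form i)

lemma isOpen_M : IsOpen {x : Fin (ℓ + 1) → ℂ | ∀ i, A.form i x ≠ 0} := by
  simp only [Set.ofPred_forall]
  exact isOpen_iInter_of_finite fun i => isOpen_ne.preimage (A.continuous_form i)

/-- The complement of a complex arrangement is path connected. -/
lemma joined_M (x₀ y : A.M) : Joined x₀ y := by
  let g : ℂ → Fin (ℓ + 1) → ℂ := fun z => x₀.1 + z • (y.1 - x₀.1)
  have hg : Continuous g := by fun_prop
  have hform (i z) : A.form i (g z) =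
      A.form i x₀.1 + z * (A.form i y.1 - A.form i x₀.1) := by
    simp [g]
  let S : Set ℂ := ⋃ i, {z | A.form i (g z) = 0}
  have hS : S.Countable := by
    refine Set.countable_iUnion fun i => Set.Subsingleton.countable fun a ha b hb => ?_
    rw [Set.mem_ofPred_eq, hform] at ha hb
    have h0 := x₀.2 i
    have hne : A.form i y.1 - A.form i x₀.1 ≠ 0 := fun h => h0 (by simpa [h] using ha)
    exact mul_right_cancel₀ hne (by linear_combination ha - hb)
  have hmem (z : ℂ) : z ∈ Sᶜ ↔ ∀ i, A.form i (g z) ≠ 0 := by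
    simp [S]
  have hconn : IsPathConnected Sᶜ :=
    hS.isPathConnected_compl_of_one_lt_rank (by simp [Complex.rank_real_complex])
  have h0 : (0 : ℂ) ∈ Sᶜ := (hmem 0).2 fun i => by simpa [hform] using x₀.2 i
  have h1 : (1 : ℂ) ∈ Sᶜ := (hmem 1).2 fun i => by simpa [hform] using y.2 i
  have hj := hconn.joinedIn 0 h0 1 h1
  exact ⟨{
    toFun := fun s => ⟨g (hj.somePath s), (hmem _).1 (hj.somePath_mem s)⟩
    continuous_toFun := Continuous.subtype_mk (hg.comp hj.somePath.continuous) _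
    source' := Subtype.ext (by simp [g])
    target' := Subtype.ext (by simp [g]) }⟩

lemma pathConnectedSpace_M (x₀ : A.M) : PathConnectedSpace A.M :=
  ⟨⟨x₀⟩, A.joined_M⟩

variable [NeZero n]

lemma hopf_surjective : Function.Surjective A.hopf := by
  rintro ⟨x, hx⟩
  induction x using Projectivization.ind with | h v hv =>
  refine ⟨⟨v, fun i hi => hx i ?_⟩, rfl⟩
  rw [Projectivization.submodule_mk, Submodule.span_singleton_le_iff_mem]
  exact hi

lemma isQuotientMap_hopf : Topology.IsQuotientMap A.hopf := by
  refine (Topology.isQuotientMap_iff _).2 ⟨Topology.isCoinducing_iff.2 fun W =>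
    ⟨fun h => ?_, fun h => h.preimage A.hopf.continuous⟩, A.hopf_surjective⟩
  refine isOpen_induced_iff.2 ⟨Subtype.val '' W, ?_, Set.preimage_image_eq W Subtype.val_injective⟩
  refine isOpen_coinduced.2 (isOpen_induced_iff.2
    ⟨Subtype.val '' (A.hopf ⁻¹' W), A.isOpen_M.isOpenMap_subtype_val _ h, ?_⟩)
  ext ⟨v, hv⟩
  constructor
  · rintro ⟨m, hm, rfl⟩
    exact ⟨A.hopf m, hm, rfl⟩
  · rintro ⟨u, hu, hv'⟩
    have h (i) : A.form i v ≠ 0 := fun hi => u.2 i (by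
      rw [hv']
      change (Projectivization.mk ℂ v hv).submodule ≤ _
      rw [Projectivization.submodule_mk, Submodule.span_singleton_le_iff_mem]
      exact hi)
    refine ⟨⟨v, h⟩, ?_, rfl⟩
    change A.hopf ⟨v, h⟩ ∈ W
    convert! hu
    exact Subtype.ext hv'.symm

/-- Multiplication by a nonzero scalar. -/
def scalar (a : ℂ) (ha : a ≠ 0) (x : A.M) : A.M :=
  ⟨a • x.1, fun i => by
    rw [map_smul, smul_eq_mul]
    exact mul_ne_zero ha (x.2 i)⟩

lemma hopf_scalar (a : ℂ) (ha : a ≠ 0) (x : A.M) : A.hopf (A.scalar a ha x) = A.hopf x :=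
  Subtype.ext ((Projectivization.mk_eq_mk_iff' _ _ _ _ _).2 ⟨a, rfl⟩)

lemma exists_of_hopf_eq {x y : A.M} (h : A.hopf x = A.hopf y) : ∃ a : ℂ, a • y.1 = x.1 :=
  (Projectivization.mk_eq_mk_iff' _ _ _ _ _).1 (congrArg Subtype.val h)

/-- The rescaling of a point to the affine chart on which the first form is `1`. -/
def normalize : C(A.M, A.M) where
  toFun x := A.scalar (A.form 0 x.1)⁻¹ (inv_ne_zero (x.2 0)) x
  continuous_toFun := by
    have h : Continuous fun x : A.M => A.form 0 x.1 :=
      (A.continuous_form 0).comp continuous_subtype_val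
    have h' : Continuous fun x : A.M => (A.form 0 x.1)⁻¹ • x.1 :=
      (h.inv₀ fun x => x.2 0).smul continuous_subtype_val
    exact h'.subtype_mk _

lemma normalize_val (x : A.M) : (A.normalize x).1 = (A.form 0 x.1)⁻¹ • x.1 := rfl

lemma normalize_factorsThrough : Function.FactorsThrough A.normalize A.hopf := by
  intro x y h
  obtain ⟨a, ha⟩ := A.exists_of_hopf_eq h
  refine Subtype.ext ?_
  have hy := y.2 0
  have hx := x.2 0
  rw [normalize_val, normalize_val, ← ha, map_smul, smul_smul, smul_eq_mul]
  congr 1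
  have ha0 : a ≠ 0 := by
    rintro rfl
    simp [← ha] at hx
  field_simp

/-- The section of the Hopf map with values in the affine chart on which the first form is `1`. -/
def hopfSection : C(A.U, A.M) :=
  A.isQuotientMap_hopf.lift A.normalize A.normalize_factorsThrough

lemma hopfSection_hopf (x : A.M) : A.hopfSection (A.hopf x) = A.normalize x :=
  DFunLike.congr_fun
    (A.isQuotientMap_hopf.lift_comp A.normalize A.normalize_factorsThrough) x

lemma hopf_hopfSection (u : A.U) : A.hopf (A.hopfSection u) = u := by
  obtain ⟨x, rfl⟩ := A.hopf_surjective u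
  rw [hopfSection_hopf]
  exact A.hopf_scalar _ (inv_ne_zero (x.2 0)) x

lemma form_hopfSection (u : A.U) : A.form 0 (A.hopfSection u).1 = 1 := by
  obtain ⟨x, rfl⟩ := A.hopf_surjective u
  rw [hopfSection_hopf, normalize_val, map_smul, smul_eq_mul, inv_mul_cancel₀ (x.2 0)]

/-- The infinite cyclic covering `U × ℂ → M`. -/
def cyclicCovering : Covering A.U A.M where
  map :=
    { toFun := fun p => A.scalar (Complex.exp p.2) (Complex.exp_ne_zero _) (A.hopfSection p.1)
      continuous_toFun := by
        have h : Continuous fun p : A.U × ℂ => Complex.exp p.2 • (A.hopfSection p.1).1 := by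
          fun_prop
        exact h.subtype_mk _ }
  map_add_period x z := by
    refine Subtype.ext ?_
    change Complex.exp (z + period) • _ = Complex.exp z • _
    rw [Complex.exp_add, Complex.exp_two_pi_mul_I, mul_one]
  eq_of_map_eq {x x' z z'} h := by
    have hx : x = x' := by
      have := congrArg A.hopf h
      change A.hopf (A.scalar _ (Complex.exp_ne_zero z) (A.hopfSection x)) =
        A.hopf (A.scalar _ (Complex.exp_ne_zero z') (A.hopfSection x')) at this
      rwa [hopf_scalar, hopf_scalar, hopf_hopfSection, hopf_hopfSection] at this
    have hz := congrArg (fun m : A.M => A.form 0 m.1) h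
    change A.form 0 (Complex.exp z • _) = A.form 0 (Complex.exp z' • _) at hz
    rw [map_smul, map_smul, form_hopfSection, form_hopfSection, smul_eq_mul, smul_eq_mul,
      mul_one, mul_one] at hz
    exact ⟨hx, Complex.exp_eq_exp_iff_exists_int.1 hz.symm⟩
  exists_lift τ := by
    obtain ⟨φ, hφ⟩ := exists_log_simplex
      ⟨fun x => A.form 0 (τ x).1, (A.continuous_form 0).comp (by fun_prop)⟩ fun x => (τ x).2 0
    refine ⟨A.hopf.comp τ, φ, ContinuousMap.ext fun x => Subtype.ext ?_⟩
    change Complex.exp (φ x) • (A.hopfSection (A.hopf (τ x))).1 = (τ x).1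
    rw [hφ, hopfSection_hopf, normalize_val]
    exact smul_inv_smul₀ ((τ x).2 0) _

lemma hopf_comp_zeroSection :
    A.hopf.comp A.cyclicCovering.zeroSection = ContinuousMap.id A.U := by
  ext1 u
  exact (A.hopf_scalar _ (Complex.exp_ne_zero _) _).trans (A.hopf_hopfSection u)

end CentralArrangement

namespace CentralArrangement

open LocalCoefficients CyclicCover
open scoped LinearAlgebra.Projectivization

variable {ℓ n : ℕ} (A : CentralArrangement ℓ n)

lemma linkingNumber_mk {x₀ : A.M} (i : Fin n) (γ : Path x₀ x₀) :
    A.linkingNumber x₀ i (Path.Homotopic.Quotient.mk γ) =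
      windingNumber (A.formMap i x₀)
        (Path.Homotopic.Quotient.mk (γ.map (A.formMap i).continuous)) := rfl

variable [NeZero n]

lemma loop_val (u : A.U) (s : unitInterval) :
    (A.cyclicCovering.loop u s).1 =
      Complex.exp (s * (2 * Real.pi * Complex.I)) • (A.hopfSection u).1 := rfl

lemma linkingNumber_loop {x₀ : A.M} (u : A.U) (c : Path x₀ (A.cyclicCovering.zeroSection u))
    (i : Fin n) :
    A.linkingNumber x₀ i (Path.Homotopic.Quotient.mk
      (c.trans ((A.cyclicCovering.loop u).trans c.symm))) = Multiplicative.ofAdd 1 := by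
  rw [linkingNumber_mk]
  have hmap : (c.trans ((A.cyclicCovering.loop u).trans c.symm)).map (A.formMap i).continuous =
      (c.map (A.formMap i).continuous).trans
        (((A.cyclicCovering.loop u).map (A.formMap i).continuous).trans
          (c.map (A.formMap i).continuous).symm) :=
    (Path.map_trans c _ _).trans (congrArg _ (Path.map_trans _ c.symm _))
  rw [hmap]
  refine windingNumber_conj _ _ 1 fun e he => ?_
  have he' : Complex.exp e = A.form i (A.hopfSection u).1 := by
    have h0 : Complex.exp e = A.form i (Complex.exp 0 • (A.hopfSection u).1) :=
      congrArg Subtype.val he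
    rwa [Complex.exp_zero, one_smul] at h0
  refine ⟨⟨⟨fun s => e + s * (2 * Real.pi * Complex.I), by fun_prop⟩, by simp, by simp⟩,
    fun s => Subtype.ext ?_⟩
  change Complex.exp (e + s * (2 * Real.pi * Complex.I)) = A.form i (A.cyclicCovering.loop u s).1
  rw [loop_val, map_smul, smul_eq_mul, Complex.exp_add, he', mul_comm]

variable {K : Type u} [Field K]

lemma character_loop {x₀ : A.M} (t : Fin n → Kˣ) (u : A.U)
    (c : Path x₀ (A.cyclicCovering.zeroSection u)) :
    A.character x₀ t (FundamentalGroup.fromPath (Path.Homotopic.Quotient.mk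
      (c.trans ((A.cyclicCovering.loop u).trans c.symm)))) = ∏ i, t i := by
  simp only [character, MonoidHom.finsetProd_apply, MonoidHom.comp_apply, zpowersHom_apply]
  refine Finset.prod_congr rfl fun i _ => ?_
  rw [show FundamentalGroup.fromPath _ = Path.Homotopic.Quotient.mk
      (c.trans ((A.cyclicCovering.loop u).trans c.symm)) from rfl, linkingNumber_loop]
  simp

/-- The local system on `U` that is the restriction of the local system on `M` with parameter `t`
to the affine chart on which the first form is `1`. -/
abbrev restrictedSystem (x₀ : A.M) (t : Fin n → Kˣ) : LocalSystem.{u, u, 0} K A.U :=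
  A.cyclicCovering.restriction (rankOne (A.character x₀ t))

theorem rank_cohomology_M (x₀ : A.M) (t : Fin n → Kˣ) (ht : ∏ i, t i = 1) (q : ℕ) :
    Module.rank K (cohomology (rankOne (A.character x₀ t)) (q + 1)) =
      Module.rank K (cohomology (A.restrictedSystem x₀ t) (q + 1)) +
        Module.rank K (cohomology (A.restrictedSystem x₀ t) q) := by
  have := A.pathConnectedSpace_M x₀
  refine A.cyclicCovering.rank_cohomology_of_trivial (fun u v => ?_) q
  rw [rankOne_map_loop _ _ _ (A.character_loop t u), ht]
  simp

theorem rank_cohomology_M_eq_zero (x₀ : A.M) (t : Fin n → Kˣ) (ht : ∏ i, t i ≠ 1) (q : ℕ) :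
    Module.rank K (cohomology (rankOne (A.character x₀ t)) (q + 1)) = 0 := by
  have := A.pathConnectedSpace_M x₀
  refine A.cyclicCovering.rank_cohomology_of_ne_one (Units.ne_zero (∏ i, t i)⁻¹) ?_
    (fun u v => rankOne_map_loop _ _ _ (A.character_loop t u) v) q
  rwa [Ne, Units.val_eq_one, inv_eq_one]

theorem rank_cohomology_U (x₀ : A.M) (t : Fin n → Kˣ)
    {χ : FundamentalGroup A.U (A.hopf x₀) →* Kˣ}
    (hχ : χ.comp (FundamentalGroup.map A.hopf x₀) = A.character x₀ t) (q : ℕ) :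
    Module.rank K (cohomology (rankOne χ) q) =
      Module.rank K (cohomology (A.restrictedSystem x₀ t) q) := by
  have := A.pathConnectedSpace_M x₀
  let e1 := Functor.isoWhiskerLeft (FundamentalGroupoid.map A.cyclicCovering.zeroSection)
    (rankOneComapIso A.hopf χ hχ)
  have h : FundamentalGroupoid.map A.cyclicCovering.zeroSection ⋙
      FundamentalGroupoid.map A.hopf = 𝟭 _ := by
    rw [← FundamentalGroupoid.map_comp, hopf_comp_zeroSection, FundamentalGroupoid.map_id]
  let e2 := Functor.isoWhiskerRight (eqToIso h) (rankOne χ)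
  exact rank_cohomology_eq_of_iso ((Functor.leftUnitor _).symm ≪≫ e2.symm ≪≫
    Functor.associator _ _ _ ≪≫ e1) q

/-- The quotient of a form by the first form, as a map `U → ℂ ∖ {0}`. -/
def ratioMap (i : Fin n) : C(A.U, PuncturedPlane) := (A.formMap i).comp A.hopfSection

lemma ratioMap_hopf (i : Fin n) (x : A.M) :
    (A.ratioMap i (A.hopf x)).1 = (A.form 0 x.1)⁻¹ * A.form i x.1 := by
  change A.form i (A.hopfSection (A.hopf x)).1 = _
  rw [hopfSection_hopf, normalize_val, map_smul, smul_eq_mul]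

/-- The character of `π₁(U)` with parameter `t`, given by the winding numbers of the quotients of
the forms by the first one. -/
def projectiveCharacter (u : A.U) (t : Fin n → Kˣ) : FundamentalGroup A.U u →* Kˣ :=
  ∏ i, (zpowersHom Kˣ (t i)).comp
    ((windingNumber (A.ratioMap i u)).comp (FundamentalGroup.map (A.ratioMap i) u))

lemma windingNumber_ratioMap (x₀ : A.M) (i : Fin n) (g : FundamentalGroup A.M x₀) :
    windingNumber (A.ratioMap i (A.hopf x₀)) (FundamentalGroup.map (A.ratioMap i) (A.hopf x₀)
      (FundamentalGroup.map A.hopf x₀ g)) =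
      A.linkingNumber x₀ i g / A.linkingNumber x₀ 0 g := by
  induction g using Quotient.inductionOn with | _ γ =>
  refine windingNumber_div (γ.map (A.formMap i).continuous) (γ.map (A.formMap 0).continuous)
    ((γ.map A.hopf.continuous).map (A.ratioMap i).continuous) fun s => ?_
  exact A.ratioMap_hopf i (γ s)

lemma projectiveCharacter_comp (x₀ : A.M) (t : Fin n → Kˣ) (ht : ∏ i, t i = 1) :
    (A.projectiveCharacter (A.hopf x₀) t).comp (FundamentalGroup.map A.hopf x₀) =
      A.character x₀ t := by
  ext1 g
  simp only [projectiveCharacter, character, MonoidHom.finsetProd_apply, MonoidHom.comp_apply,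
    windingNumber_ratioMap, zpowersHom_apply, toAdd_div, zpow_sub]
  rw [Finset.prod_mul_distrib, Finset.prod_inv_distrib, Finset.prod_zpow, ht, one_zpow, inv_one,
    mul_one]

lemma mem_charVarU_iff (x₀ : A.M) (q d : ℕ) (t : Fin n → Kˣ) :
    t ∈ A.charVarU K x₀ q d ↔ ∏ i, t i = 1 ∧
      (d : Cardinal) ≤ Module.rank K (cohomology (A.restrictedSystem x₀ t) q) := by
  constructor
  · rintro ⟨ht, χ, hχ, hd⟩
    exact ⟨ht, hd.trans_eq (A.rank_cohomology_U x₀ t hχ q)⟩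
  · rintro ⟨ht, hd⟩
    have hχ := A.projectiveCharacter_comp x₀ t ht
    exact ⟨ht, _, hχ, hd.trans_eq (A.rank_cohomology_U x₀ t hχ q).symm⟩

lemma mem_charVarM_iff (x₀ : A.M) (q d : ℕ) (t : Fin n → Kˣ) (ht : ∏ i, t i = 1) :
    t ∈ A.charVarM K x₀ (q + 1) d ↔ (d : Cardinal) ≤
      Module.rank K (cohomology (A.restrictedSystem x₀ t) (q + 1)) +
        Module.rank K (cohomology (A.restrictedSystem x₀ t) q) := by
  rw [← A.rank_cohomology_M x₀ t ht q]
  rfl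

lemma prod_eq_one_of_mem_charVarM (x₀ : A.M) (q d : ℕ) (hd : 1 ≤ d) (t : Fin n → Kˣ)
    (h : t ∈ A.charVarM K x₀ (q + 1) d) : ∏ i, t i = 1 := by
  by_contra ht
  have h' : (d : Cardinal) ≤ Module.rank K _ := h
  rw [A.rank_cohomology_M_eq_zero x₀ t ht q] at h'
  have : d ≤ 0 := by exact_mod_cast h'
  omega

theorem charVarM_inter_eq (x₀ : A.M) (q d : ℕ) :
    A.charVarM K x₀ (q + 1) d ∩ {t | ∏ i, t i = 1} =
      ⋃ j ∈ Finset.range (d + 1), A.charVarU K x₀ (q + 1) (d - j) ∩ A.charVarU K x₀ q j := by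
  ext t
  simp only [Set.mem_inter_iff, Set.mem_iUnion, Finset.mem_range, mem_charVarU_iff, exists_prop,
    Nat.lt_succ_iff]
  constructor
  · rintro ⟨h, ht⟩
    obtain ⟨j, hj, h1, h2⟩ := Cardinal.natCast_le_add_iff.1 ((A.mem_charVarM_iff x₀ q d t ht).1 h)
    exact ⟨j, hj, ⟨ht, h1⟩, ht, h2⟩
  · rintro ⟨j, hj, ⟨ht, h1⟩, -, h2⟩
    exact ⟨(A.mem_charVarM_iff x₀ q d t ht).2 (Cardinal.natCast_le_add_iff.2 ⟨j, hj, h1, h2⟩), ht⟩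

end CentralArrangement

end

theorem mainTheorem7 {ℓ n : ℕ} [NeZero n] (A : CentralArrangement ℓ n)
    (K : Type u) [Field K] [IsAlgClosed K] (x₀ : A.M) (q : ℕ) (hq : 1 ≤ q) :
    (∀ d : ℕ, 1 ≤ d →
      A.charVarM K x₀ q d =
        ⋃ j ∈ Finset.range (d + 1), A.charVarU K x₀ q (d - j) ∩ A.charVarU K x₀ (q - 1) j) ∧
    (∀ d : ℕ,
      A.charVarM K x₀ q d ∩ {t | ∏ i, t i = 1} =
        ⋃ j ∈ Finset.range (d + 1), A.charVarU K x₀ q (d - j) ∩ A.charVarU K x₀ (q - 1) j) ∧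
    (∀ t : Fin n → Kˣ, ∏ i, t i = 1 →
      depth (A.charVarM K x₀ q) t =
        depth (A.charVarU K x₀ q) t + depth (A.charVarU K x₀ (q - 1)) t) := by
  obtain ⟨q, rfl⟩ := Nat.exists_eq_add_of_le' hq
  rw [Nat.add_sub_cancel]
  refine ⟨fun d hd => ?_, A.charVarM_inter_eq x₀ q, fun t ht => ?_⟩
  · rw [← A.charVarM_inter_eq x₀ q d, Set.inter_eq_left.2]
    exact fun t h => A.prod_eq_one_of_mem_charVarM x₀ q d hd t h
  · rw [depth_eq_toENat _ t _ fun d => A.mem_charVarM_iff x₀ q d t ht,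
      depth_eq_toENat _ t _ fun d => (A.mem_charVarU_iff x₀ (q + 1) d t).trans
        (and_iff_right ht),
      depth_eq_toENat _ t _ fun d => (A.mem_charVarU_iff x₀ q d t).trans (and_iff_right ht),
      map_add]
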